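/- Let $d\ge 1$, write $x=(x',x_d)\in\mathbb R^d$, and let $B_1\subset\mathbb R^d$ be the open unit ball. Let $a>0$. Let $F:\mathrm{Sym}(d)\to\mathbb R$ be uniformly elliptic: for some constants $0<\lambda\le\Lambda$, $\lambda|N|\le F(M+N)-F(M)\le\Lambda|N|$ for all symmetric $M,N$ with $N\ge 0$, where $|\cdot|$ is the spectral norm. Consider the Dirichlet problem $$|x_d|^aF(D^2u)=0\ \text{ in } B_1,\qquad u=\varphi\ \text{ on }\partial B_1. \tag{$*$}$$ A function $u\in C(\overline{B_1})$ with $u=\varphi$ on $\partial B_1$ is an $L^p$ viscosity solution of $(*)$ if, for every continuous $\psi\in W^{2,p}_{\mathrm{loc}}(B_1)$ and every $x_0\in B_1$, $$\operatorname*{ess\,lim\,sup}_{x\to x_0}\,|x_d|^aF(D^2\psi(x))\ge 0\ \text{ whenever } u-\psi \text{ has a local maximum at } x_0,$$ $$\operatorname*{ess\,lim\,inf}_{x\to x_0}\,|x_d|^aF(D^2\psi(x))\le 0\ \text{ whenever } u-\psi \text{ has a local minimum at } x_0.$$ It is a $C$ viscosity solution of $(*)$ if, for every $\psi\in C^2(B_1)$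 and every $x_0\in B_1$, $|(x_0)_d|^aF(D^2\psi(x_0))\ge 0$ (respectively $\le 0$) whenever $u-\psi$ has a local maximum (respectively minimum) at $x_0$. (i) If $1\le p<\infty$ and $ap<1$ (that is, the function $|x_d|^{-a}$ belongs to $L^p(B_1)$), then for every uniformly elliptic $F$ and every $\varphi:\partial B_1\to\mathbb R$, the problem $(*)$ has at most one $L^p$ viscosity solution $u\in C(\overline{B_1})$. (ii) Uniqueness fails for $C$ viscosity solutions: for every $d\ge1$ and $a>0$ there are a uniformly elliptic $F$ and boundary data $\varphi$ for which $(*)$ has two distinct $C$ viscosity solutions in $C(\overline{B_1})$. -/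

import Mathlib

open MeasureTheory Filter Topology
open scoped ENNReal ContDiff

noncomputable section

/-- The `i`-th coordinate vector of `ℝ^d`. -/
def coordVec {d : ℕ} (i : Fin d) : EuclideanSpace ℝ (Fin d) := EuclideanSpace.single i 1

/-- The classical partial derivative `∂_i g` at `x`. -/
def partialDeriv {d : ℕ} (i : Fin d) (g : EuclideanSpace ℝ (Fin d) → ℝ)
    (x : EuclideanSpace ℝ (Fin d)) : ℝ :=
  fderiv ℝ g x (coordVec i)

/-- The classical Hessian `D²g(x)`. -/
def hessianMatrix {d : ℕ} (g : EuclideanSpace ℝ (Fin d) → ℝ) (x : EuclideanSpace ℝ (Fin d)) :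
    Matrix (Fin d) (Fin d) ℝ :=
  Matrix.of fun i j => partialDeriv j (partialDeriv i g) x

/-- `g ∈ L^p_loc(U)`: `g` is in `L^p(K)` for every compact `K ⊆ U`. -/
def MemLpLoc {d : ℕ} (p : ℝ≥0∞) (U : Set (EuclideanSpace ℝ (Fin d)))
    (g : EuclideanSpace ℝ (Fin d) → ℝ) : Prop :=
  ∀ K : Set (EuclideanSpace ℝ (Fin d)), IsCompact K → K ⊆ U → MemLp g p (volume.restrict K)

/-- `h = ∂_i g` in the weak sense in `U`: `∫ g ∂_i η = - ∫ h η` for every `η ∈ C_c^∞(U)`.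
It is used for locally integrable `g` and `h`. -/
def IsWeakPartialDeriv {d : ℕ} (U : Set (EuclideanSpace ℝ (Fin d))) (i : Fin d)
    (g h : EuclideanSpace ℝ (Fin d) → ℝ) : Prop :=
  ∀ η : EuclideanSpace ℝ (Fin d) → ℝ, ContDiff ℝ ∞ η → HasCompactSupport η → tsupport η ⊆ U →
    ∫ x, g x * partialDeriv i η x = - ∫ x, h x * η x

/-- `φ ∈ W^{2,p}_loc(U)`, and `H` represents its weak Hessian `D²φ` (which is determined, and
symmetric, almost everywhere in `U`). -/
def IsW2pLocWithHessian {d : ℕ} (p : ℝ≥0∞) (U : Set (EuclideanSpace ℝ (Fin d)))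
    (φ : EuclideanSpace ℝ (Fin d) → ℝ)
    (H : EuclideanSpace ℝ (Fin d) → Matrix (Fin d) (Fin d) ℝ) : Prop :=
  MemLpLoc p U φ ∧
    (∃ G : Fin d → EuclideanSpace ℝ (Fin d) → ℝ,
      (∀ i, MemLpLoc p U (G i) ∧ IsWeakPartialDeriv U i φ (G i)) ∧
      (∀ i j, MemLpLoc p U (fun x => H x i j) ∧
        IsWeakPartialDeriv U j (G i) (fun x => H x i j)))

/-- `ess limsup_{x → x₀} g(x) = inf_{r > 0} ess sup_{B_r(x₀)} g`, with values in `[-∞, ∞]`. -/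
def essLimsupAt {d : ℕ} (g : EuclideanSpace ℝ (Fin d) → ℝ) (x₀ : EuclideanSpace ℝ (Fin d)) :
    EReal :=
  limsup (fun x => (g x : EReal)) (𝓝 x₀ ⊓ ae volume)

/-- `ess liminf_{x → x₀} g(x) = sup_{r > 0} ess inf_{B_r(x₀)} g`, with values in `[-∞, ∞]`. -/
def essLiminfAt {d : ℕ} (g : EuclideanSpace ℝ (Fin d) → ℝ) (x₀ : EuclideanSpace ℝ (Fin d)) :
    EReal :=
  liminf (fun x => (g x : EReal)) (𝓝 x₀ ⊓ ae volume)

/-- `u ∈ C(U)` is an `L^p` viscosity subsolution of `G(D²u, x) = f` in the open set `U`. The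
continuous representative of a test function is used. -/
def IsLpViscositySubsolution {d : ℕ} (p : ℝ≥0∞) (U : Set (EuclideanSpace ℝ (Fin d)))
    (G : Matrix (Fin d) (Fin d) ℝ → EuclideanSpace ℝ (Fin d) → ℝ)
    (f u : EuclideanSpace ℝ (Fin d) → ℝ) : Prop :=
  ContinuousOn u U ∧
    ∀ (φ : EuclideanSpace ℝ (Fin d) → ℝ)
      (H : EuclideanSpace ℝ (Fin d) → Matrix (Fin d) (Fin d) ℝ),
      ContinuousOn φ U → IsW2pLocWithHessian p U φ H →
      ∀ x₀ ∈ U, IsLocalMax (fun x => u x - φ x) x₀ →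
        0 ≤ essLimsupAt (fun x => G (H x) x - f x) x₀

/-- `u ∈ C(U)` is an `L^p` viscosity supersolution of `G(D²u, x) = f` in the open set `U`. -/
def IsLpViscositySupersolution {d : ℕ} (p : ℝ≥0∞) (U : Set (EuclideanSpace ℝ (Fin d)))
    (G : Matrix (Fin d) (Fin d) ℝ → EuclideanSpace ℝ (Fin d) → ℝ)
    (f u : EuclideanSpace ℝ (Fin d) → ℝ) : Prop :=
  ContinuousOn u U ∧
    ∀ (φ : EuclideanSpace ℝ (Fin d) → ℝ)
      (H : EuclideanSpace ℝ (Fin d) → Matrix (Fin d) (Fin d) ℝ),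
      ContinuousOn φ U → IsW2pLocWithHessian p U φ H →
      ∀ x₀ ∈ U, IsLocalMin (fun x => u x - φ x) x₀ →
        essLiminfAt (fun x => G (H x) x - f x) x₀ ≤ 0

/-- `L^p` viscosity solutions of `G(D²u, x) = f` in `U`. -/
def IsLpViscositySolution {d : ℕ} (p : ℝ≥0∞) (U : Set (EuclideanSpace ℝ (Fin d)))
    (G : Matrix (Fin d) (Fin d) ℝ → EuclideanSpace ℝ (Fin d) → ℝ)
    (f u : EuclideanSpace ℝ (Fin d) → ℝ) : Prop :=
  IsLpViscositySubsolution p U G f u ∧ IsLpViscositySupersolution p U G f u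

/-- `u ∈ C(U)` is a `C` viscosity solution (both a subsolution and a supersolution) of
`G(D²u, x) = f` in the open set `U`. -/
def IsCViscositySolution {d : ℕ} (U : Set (EuclideanSpace ℝ (Fin d)))
    (G : Matrix (Fin d) (Fin d) ℝ → EuclideanSpace ℝ (Fin d) → ℝ)
    (f u : EuclideanSpace ℝ (Fin d) → ℝ) : Prop :=
  ContinuousOn u U ∧
    ∀ φ : EuclideanSpace ℝ (Fin d) → ℝ, ContDiffOn ℝ 2 φ U → ∀ x₀ ∈ U,
      (IsLocalMax (fun x => u x - φ x) x₀ → f x₀ ≤ G (hessianMatrix φ x₀) x₀) ∧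
      (IsLocalMin (fun x => u x - φ x) x₀ → G (hessianMatrix φ x₀) x₀ ≤ f x₀)

open scoped Matrix.Norms.L2Operator in
/-- `F` is uniformly elliptic with constants `0 < lam ≤ Lam` on symmetric matrices; the norm of a
matrix is its spectral norm. Values of `F` at non-symmetric matrices play no role. -/
def IsUniformlyElliptic {d : ℕ} (lam Lam : ℝ) (F : Matrix (Fin d) (Fin d) ℝ → ℝ) : Prop :=
  0 < lam ∧ lam ≤ Lam ∧
    ∀ M N : Matrix (Fin d) (Fin d) ℝ, M.IsSymm → N.PosSemidef →
      lam * ‖N‖ ≤ F (M + N) - F M ∧ F (M + N) - F M ≤ Lam * ‖N‖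

/-- The degenerate operator `(M, x) ↦ |x_d|^a F(M)`, where `d = n + 1` and `x_d` is the last
coordinate of `x`. -/
def degenerateOperator {n : ℕ} (a : ℝ) (F : Matrix (Fin (n + 1)) (Fin (n + 1)) ℝ → ℝ)
    (M : Matrix (Fin (n + 1)) (Fin (n + 1)) ℝ) (x : EuclideanSpace ℝ (Fin (n + 1))) : ℝ :=
  |x (Fin.last n)| ^ a * F M

/-- `u`, continuous on the closed unit ball, is an `L^p` viscosity solution of
`|x_d|^a F(D²u) = 0` in `B_1` with `u = φ` on `∂B_1`. -/
def IsLpDirichletSolution {n : ℕ} (p : ℝ≥0∞) (a : ℝ)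
    (F : Matrix (Fin (n + 1)) (Fin (n + 1)) ℝ → ℝ)
    (φ u : EuclideanSpace ℝ (Fin (n + 1)) → ℝ) : Prop :=
  ContinuousOn u (Metric.closedBall 0 1) ∧
    IsLpViscositySolution p (Metric.ball 0 1) (degenerateOperator a F) (fun _ => 0) u ∧
    ∀ x ∈ Metric.sphere (0 : EuclideanSpace ℝ (Fin (n + 1))) 1, u x = φ x

/-- `u`, continuous on the closed unit ball, is a `C` viscosity solution of
`|x_d|^a F(D²u) = 0` in `B_1` with `u = φ` on `∂B_1`. -/
def IsCDirichletSolution {n : ℕ} (a : ℝ)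
    (F : Matrix (Fin (n + 1)) (Fin (n + 1)) ℝ → ℝ)
    (φ u : EuclideanSpace ℝ (Fin (n + 1)) → ℝ) : Prop :=
  ContinuousOn u (Metric.closedBall 0 1) ∧
    IsCViscositySolution (Metric.ball 0 1) (degenerateOperator a F) (fun _ => 0) u ∧
    ∀ x ∈ Metric.sphere (0 : EuclideanSpace ℝ (Fin (n + 1))) 1, u x = φ x

end

/-! Part (i) is a comparison principle resting on two ideas. The first removes the weight. The
function `|x_d|^(2-a)` lies in `W^{2,p}_loc` exactly because `|x_d|^(-a)` is locally in `L^p`, and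
`|x_d|^a` times its second derivative is a positive constant. Subtracting a small multiple of it
from a quadratic polynomial with `F(T) ≤ 0` gives an admissible test function on which the weighted
operator is at most a negative constant off a null set. Hence a polynomial so perturbed can touch a
subsolution from above only if `F(T) > 0`, wherever the contact point lies
(`IsLpViscositySubsolution.pos_of_isLocalMax`); supersolutions are symmetric.

The second is the theory for `F(D²u) = 0`. If `u - v` had an interior positive maximum,
sup-convolutions of `u + δ|x|²/2` and `-v` would have second-order expansions with Hessians of
nonpositive sum (`exists_second_order_expansions`). These pass to `u` and `v` at two possibly
different points, harmless since `F` does not depend on `x`, and contradict ellipticity.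
Alexandrov's theorem is bypassed: at points where the sum of the sup-convolutions is touched from
above by a plane, their slopes satisfy a Lipschitz bound, so Stepanov's theorem makes them
differentiable almost everywhere there. The contact set is not null because the slopes cover a ball.

Part (ii) holds because the pointwise condition is void on `x_d = 0`, where the weight vanishes. For
the Laplacian, any continuous function harmonic on both sides is a solution. The Poisson kernel with
pole `-e_d`, reflected evenly from the upper half-ball, vanishes on the sphere but not at the
origin; the zero function is the second solution. -/

/-! ### Differentiability almost everywhere from pointwise Lipschitz bounds -/

section Stepanov

variable {E : Type*} [NormedAddCommGroup E]

/-- A function which satisfies a Lipschitz bound between points of `A` and arbitrary points has a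
globally Lipschitz majorant agreeing with it on `A`. -/
theorem exists_lipschitzWith_majorant (A : Set E) (C : NNReal) (q : E → ℝ)
    (h : ∀ a ∈ A, ∀ y, |q y - q a| ≤ C * ‖y - a‖) (hA : A.Nonempty) :
    ∃ L : E → ℝ, LipschitzWith C L ∧ (∀ y, q y ≤ L y) ∧ ∀ a ∈ A, L a = q a := by
  have : Nonempty A := hA.to_subtype
  have hb : ∀ (y : E) (a : A), q y ≤ q a + C * ‖y - a‖ := fun y a => by
    linarith [(abs_le.1 (h a a.2 y)).2]
  have hbdd : ∀ y : E, BddBelow (Set.range fun a : A => q a + C * ‖y - a‖) := fun y =>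
    ⟨q y, by rintro _ ⟨a, rfl⟩; exact hb y a⟩
  -- McShane's construction: the infimum of the cones of slope `C` over the points of `A`.
  refine ⟨fun y => ⨅ a : A, (q a + C * ‖y - a‖), ?_, fun y => le_ciInf (hb y), fun a ha => ?_⟩
  · refine LipschitzWith.of_le_add_mul C fun x y => ?_
    rw [ciInf_add (hbdd y)]
    refine le_ciInf fun a => (ciInf_le (hbdd x) a).trans ?_
    have h1 : ‖x - a‖ ≤ ‖y - a‖ + dist x y := by
      rw [dist_eq_norm]
      calc ‖x - a‖ = ‖(y - a) + (x - y)‖ := by congr 1; abel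
        _ ≤ _ := norm_add_le _ _
    nlinarith [C.2, mul_le_mul_of_nonneg_left h1 C.2]
  · refine le_antisymm ?_ (le_ciInf (hb a))
    refine (ciInf_le (hbdd a) ⟨a, ha⟩).trans ?_
    simp

variable [NormedSpace ℝ E]

/-- A function squeezed between two differentiable functions which agree with it at a point is
differentiable there. -/
theorem differentiableAt_of_le_of_le {f g h : E → ℝ} {x : E} (hfg : ∀ y, f y ≤ g y)
    (hgh : ∀ y, g y ≤ h y) (hf : DifferentiableAt ℝ f x) (hh : DifferentiableAt ℝ h x)
    (hfx : f x = g x) (hhx : h x = g x) : DifferentiableAt ℝ g x := by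
  have hmin : IsLocalMin (fun y => h y - f y) x :=
    Eventually.of_forall fun y => by
      have := hfg y; have := hgh y
      simp only [hfx, hhx, sub_self]; linarith
  have hd : fderiv ℝ h x = fderiv ℝ f x := by
    have := hmin.hasFDerivAt_eq_zero (hh.hasFDerivAt.sub hf.hasFDerivAt)
    exact sub_eq_zero.1 this
  refine ⟨fderiv ℝ f x, ?_⟩
  have h1 := hf.hasFDerivAt
  have h2 := hh.hasFDerivAt
  rw [hd] at h2
  rw [hasFDerivAt_iff_isLittleO_nhds_zero, Asymptotics.isLittleO_iff] at h1 h2 ⊢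
  intro c hc
  filter_upwards [h1 hc, h2 hc] with y h1 h2
  rw [Real.norm_eq_abs, abs_le] at h1 h2 ⊢
  have := hfg (x + y); have := hgh (x + y)
  constructor <;> linarith [h1.1, h2.2]

variable [FiniteDimensional ℝ E] [MeasurableSpace E] [BorelSpace E]

/-- On `A` the function is squeezed between two Lipschitz functions, the second built from `-q`, and
Rademacher's theorem applies to both. No measurability of `A` or `q` is needed. -/
theorem ae_differentiableAt_real_of_lipschitz_at (μ : Measure E) [μ.IsAddHaarMeasure] (A : Set E)
    (C : NNReal) (q : E → ℝ) (h : ∀ a ∈ A, ∀ y, |q y - q a| ≤ C * ‖y - a‖) :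
    ∀ᵐ x ∂μ, x ∈ A → DifferentiableAt ℝ q x := by
  rcases A.eq_empty_or_nonempty with rfl | hA
  · simp
  obtain ⟨L, hL, hqL, hLA⟩ := exists_lipschitzWith_majorant A C q h hA
  obtain ⟨L', hL', hqL', hLA'⟩ := exists_lipschitzWith_majorant A C (fun x => - q x)
    (fun a ha y => by rw [← abs_neg]; convert h a ha y using 2; ring) hA
  filter_upwards [hL.ae_differentiableAt (μ := μ), hL'.ae_differentiableAt (μ := μ)] with x h1 h2 hx
  refine differentiableAt_of_le_of_le (f := fun y => - L' y) (h := L) (fun y => ?_) hqL h2.neg h1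
    ?_ (hLA x hx)
  · have := hqL' y; linarith
  · rw [hLA' x hx]; ring

/-- A version of Stepanov's theorem. -/
theorem ae_differentiableAt_of_lipschitz_at {ι : Type*} [Fintype ι] (μ : Measure E)
    [μ.IsAddHaarMeasure] (A : Set E)
    (C : NNReal) (q : E → EuclideanSpace ℝ ι) (h : ∀ a ∈ A, ∀ y, ‖q y - q a‖ ≤ C * ‖y - a‖) :
    ∀ᵐ x ∂μ, x ∈ A → DifferentiableAt ℝ q x := by
  have : ∀ᵐ x ∂μ, ∀ i, x ∈ A → DifferentiableAt ℝ (fun y => q y i) x := by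
    rw [ae_all_iff]
    intro i
    refine ae_differentiableAt_real_of_lipschitz_at μ A C _ fun a ha y => ?_
    refine le_trans ?_ (h a ha y)
    simpa using PiLp.norm_apply_le (q y - q a) i
  filter_upwards [this] with x hx hxA
  exact differentiableAt_euclidean.2 fun i => hx i hxA

end Stepanov

/-- Lipschitz maps of a Euclidean space send null sets to null sets. -/
theorem LipschitzOnWith.volume_image_eq_zero {d : ℕ} {A : Set (EuclideanSpace ℝ (Fin d))}
    {C : NNReal} {q : EuclideanSpace ℝ (Fin d) → EuclideanSpace ℝ (Fin d)}
    (h : LipschitzOnWith C q A) (hA : volume A = 0) : volume (q '' A) = 0 := by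
  -- Lebesgue and `d`-dimensional Hausdorff measure are both Haar, hence have the same null sets,
  -- and Hausdorff measure behaves well under Lipschitz maps.
  have hH : (Measure.hausdorffMeasure d : Measure (EuclideanSpace ℝ (Fin d))).IsAddHaarMeasure := by
    simpa using MeasureTheory.isAddHaarMeasure_hausdorffMeasure (E := EuclideanSpace ℝ (Fin d))
  have h1 : (Measure.hausdorffMeasure d : Measure (EuclideanSpace ℝ (Fin d))) A = 0 :=
    Measure.absolutelyContinuous_isAddHaarMeasure _ volume hA
  have h2 := h.hausdorffMeasure_image_le (d := d) (Nat.cast_nonneg d)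
  rw [h1, mul_zero] at h2
  exact Measure.absolutelyContinuous_isAddHaarMeasure _
    (Measure.hausdorffMeasure d : Measure (EuclideanSpace ℝ (Fin d))) (le_antisymm h2 bot_le)

/-! ### Slopes and second-order expansions of semiconvex functions -/

section Semiconvex

variable {E : Type*} [NormedAddCommGroup E] [InnerProductSpace ℝ E]

local notation "⟪" x ", " y "⟫" => inner ℝ x y

/-- If `q` is a field of slopes of a semiconvex function `f`, and `f` is touched from above by a
paraboloid at `a`, then `q` satisfies a Lipschitz bound at `a`. -/
theorem norm_slope_sub_le {f : E → ℝ} {q : E → E} {K : ℝ} (hK : 0 ≤ K)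
    (hf : ∀ y z, f y + ⟪q y, z - y⟫ - K / 2 * ‖z - y‖ ^ 2 ≤ f z) {a b : E}
    (ha : ∀ z, f z ≤ f a + ⟪b, z - a⟫ + K / 2 * ‖z - a‖ ^ 2) :
    q a = b ∧ ∀ y, ‖q y - q a‖ ≤ 3 * K * ‖y - a‖ := by
  have hb : q a = b := by
    by_contra hne
    have hpos : 0 < ‖q a - b‖ := norm_pos_iff.2 (sub_ne_zero.2 hne)
    -- Along `q a - b` the two paraboloids at `a` force `1 ≤ t * K`; this `t` violates it, also for
    -- `K = 0`.
    set t : ℝ := 1 / (K + 1) with ht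
    have htpos : 0 < t := by positivity
    have h1 := (hf a (a + t • (q a - b))).trans (ha _)
    have h2 : ⟪q a, t • (q a - b)⟫ - ⟪b, t • (q a - b)⟫ = t * ‖q a - b‖ ^ 2 := by
      rw [← inner_sub_left, inner_smul_right, real_inner_self_eq_norm_sq]
    simp only [add_sub_cancel_left, norm_smul, Real.norm_of_nonneg htpos.le] at h1
    have h3 : t * ‖q a - b‖ ^ 2 ≤ K * (t * ‖q a - b‖) ^ 2 := by nlinarith
    have h4 : t * (K + 1) = 1 := by rw [ht]; field_simp
    have h5 : 0 < t * ‖q a - b‖ ^ 2 := by positivity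
    have h6 : K * (t * ‖q a - b‖) ^ 2 = (t * K) * (t * ‖q a - b‖ ^ 2) := by ring
    have h7 : t * K = 1 - t := by linarith
    rw [h6, h7] at h3
    nlinarith
  refine ⟨hb, fun y => ?_⟩
  rcases eq_or_ne (q y) (q a) with hqa | hqa
  · rw [hqa, sub_self, norm_zero]; positivity
  have hpos : 0 < ‖q y - q a‖ := norm_pos_iff.2 (sub_ne_zero.2 hqa)
  rcases eq_or_ne y a with rfl | hya
  · simp
  set s := ‖y - a‖ with hs
  have hspos : 0 < s := norm_pos_iff.2 (sub_ne_zero.2 hya)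
  -- A step of length `‖y - a‖` in the direction of the slope difference. The quadratic errors of
  -- the three inequalities below add up to `K / 2 * (4 + 1 + 1) * s ^ 2`, whence the factor `3`.
  set w : E := (s / ‖q y - q a‖) • (q y - q a) with hw
  have hwn : ‖w‖ = s := by
    rw [hw, norm_smul, Real.norm_of_nonneg (by positivity)]; field_simp
  have hwi : ⟪q y, w⟫ - ⟪q a, w⟫ = s * ‖q y - q a‖ := by
    rw [← inner_sub_left, hw, inner_smul_right, real_inner_self_eq_norm_sq]; field_simp
  have h1 := ha (y + w)
  have h2 := hf y (y + w)
  have h3 := hf a y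
  rw [← hb] at h1
  have h4 : y + w - a = (y - a) + w := by abel
  have h5 : ‖y + w - a‖ ≤ 2 * s := by
    rw [h4]; refine (norm_add_le _ _).trans ?_; rw [hwn]; linarith
  have h6 : ‖y + w - a‖ ^ 2 ≤ 4 * s ^ 2 := by
    nlinarith [norm_nonneg (y + w - a)]
  rw [add_sub_cancel_left, hwn] at h2
  have h7 : ⟪q a, y + w - a⟫ = ⟪q a, y - a⟫ + ⟪q a, w⟫ := by rw [h4, inner_add_right]
  rw [h7] at h1
  have h8 : K / 2 * ‖y + w - a‖ ^ 2 ≤ K / 2 * (4 * s ^ 2) := by gcongr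
  have h9 : s * ‖q y - q a‖ ≤ s * (3 * K * s) := by nlinarith
  exact le_of_mul_le_mul_left h9 hspos

/-- A discrete integration estimate. -/
theorem le_of_increment_le {φ s : ℝ → ℝ} {K α β : ℝ}
    (hφ : ∀ t ∈ Set.Icc (0 : ℝ) 1, ∀ t' ∈ Set.Icc (0 : ℝ) 1,
      φ t + s t * (t' - t) - K * (t' - t) ^ 2 ≤ φ t')
    (hs : ∀ t ∈ Set.Icc (0 : ℝ) 1, s t ≤ α + β * t) : φ 1 ≤ φ 0 + α + β / 2 := by
  have hN : ∀ N : ℕ, 0 < N → φ 1 ≤ φ 0 + α + β / 2 + (β / 2 + K) * ((N : ℝ))⁻¹ := by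
    intro N hN
    have hN' : (0 : ℝ) < N := by exact_mod_cast hN
    have key : ∀ k : ℕ, k ≤ N → φ (k / N) ≤ φ 0 + α * (k / N) + β * (k * (k + 1)) / (2 * N ^ 2)
        + K * k / N ^ 2 := by
      intro k
      induction k with
      | zero => simp
      | succ k ih =>
        intro hk
        have ih := ih (by omega)
        have hk' : ((k : ℝ) + 1) ≤ N := by exact_mod_cast hk
        have m1 : ((k : ℝ) + 1) / N ∈ Set.Icc (0 : ℝ) 1 :=
          ⟨by positivity, by rw [div_le_one hN']; exact hk'⟩
        have m0 : (k : ℝ) / N ∈ Set.Icc (0 : ℝ) 1 :=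
          ⟨by positivity, by rw [div_le_one hN']; linarith⟩
        -- Stepping backwards from the right endpoint turns the support from below into an upper
        -- bound for the increment.
        have h1 := hφ _ m1 _ m0
        have h2 := hs _ m1
        have e : (k : ℝ) / N - (k + 1) / N = - (N : ℝ)⁻¹ := by field_simp; ring
        rw [e] at h1
        have h3 : s ((k + 1) / N) * (N : ℝ)⁻¹ ≤ (α + β * ((k + 1) / N)) * (N : ℝ)⁻¹ := by gcongr
        push_cast
        have h4 : φ ((k + 1) / N) ≤ φ (k / N) + (α + β * ((k + 1) / N)) * (N : ℝ)⁻¹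
          + K * ((N : ℝ)⁻¹) ^ 2 := by nlinarith
        refine h4.trans ((add_le_add_left (add_le_add_left ih _) _).trans (le_of_eq ?_))
        field_simp
        ring
    have := key N le_rfl
    rw [div_self hN'.ne'] at this
    refine this.trans (le_of_eq ?_)
    field_simp
    ring
  have hlim : Tendsto (fun N : ℕ => φ 0 + α + β / 2 + (β / 2 + K) * ((N : ℝ))⁻¹) atTop
      (𝓝 (φ 0 + α + β / 2 + (β / 2 + K) * 0)) :=
    (tendsto_inv_atTop_nhds_zero_nat.const_mul _).const_add _
  rw [mul_zero, add_zero] at hlim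
  exact ge_of_tendsto hlim (eventually_atTop.2 ⟨1, fun N h => hN N h⟩)

/-- Reversing time, `t ↦ 1 - t`, exchanges upper and lower bounds. -/
theorem le_of_le_increment {φ s : ℝ → ℝ} {K α β : ℝ}
    (hφ : ∀ t ∈ Set.Icc (0 : ℝ) 1, ∀ t' ∈ Set.Icc (0 : ℝ) 1,
      φ t + s t * (t' - t) - K * (t' - t) ^ 2 ≤ φ t')
    (hs : ∀ t ∈ Set.Icc (0 : ℝ) 1, α + β * t ≤ s t) : φ 0 + α + β / 2 ≤ φ 1 := by
  have := le_of_increment_le (φ := fun t => φ (1 - t)) (s := fun t => - s (1 - t)) (K := K)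
    (α := - (α + β)) (β := β) (fun t ht t' ht' => ?_) (fun t ht => ?_)
  · simp only [sub_self, sub_zero] at this; linarith
  · have := hφ (1 - t) ⟨by linarith [ht.2], by linarith [ht.1]⟩
      (1 - t') ⟨by linarith [ht'.2], by linarith [ht'.1]⟩
    convert this using 1
    ring
  · have := hs (1 - t) ⟨by linarith [ht.2], by linarith [ht.1]⟩
    linarith

/-- Second-order Taylor expansion of a semiconvex function at a point where its slope field is
differentiable. -/
theorem taylor_of_hasFDerivAt_slope {f : E → ℝ} {q : E → E} {K : ℝ}
    (hf : ∀ y z, f y + ⟪q y, z - y⟫ - K / 2 * ‖z - y‖ ^ 2 ≤ f z) {x : E} {M : E →L[ℝ] E}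
    (hq : HasFDerivAt q M x) {η : ℝ} (hη : 0 < η) :
    ∀ᶠ h in 𝓝 (0 : E), |f (x + h) - f x - ⟪q x, h⟫ - ⟪M h, h⟫ / 2| ≤ η * ‖h‖ ^ 2 := by
  rw [hasFDerivAt_iff_isLittleO_nhds_zero, Asymptotics.isLittleO_iff] at hq
  -- The tolerance `2 * η` for the slope becomes `η` for the function, since it is integrated
  -- against `t` over the unit interval.
  obtain ⟨ε, hε, hball⟩ := Metric.eventually_nhds_iff.1 (hq (by positivity : 0 < 2 * η))
  refine Metric.eventually_nhds_iff.2 ⟨ε, hε, fun h hh => ?_⟩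
  rw [dist_zero_right] at hh
  have hslope : ∀ t ∈ Set.Icc (0 : ℝ) 1,
      |⟪q (x + t • h), h⟫ - ⟪q x, h⟫ - t * ⟪M h, h⟫| ≤ 2 * η * t * ‖h‖ ^ 2 := by
    intro t ht
    have hth : ‖t • h‖ = t * ‖h‖ := by rw [norm_smul, Real.norm_of_nonneg ht.1]
    have h1 := @hball (t • h) (by
      rw [dist_zero_right, hth]; nlinarith [ht.2, norm_nonneg h])
    have h2 : ⟪q (x + t • h), h⟫ - ⟪q x, h⟫ - t * ⟪M h, h⟫
        = ⟪q (x + t • h) - q x - M (t • h), h⟫ := by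
      rw [inner_sub_left, inner_sub_left, map_smul, inner_smul_left]; simp
    rw [h2]
    refine (abs_real_inner_le_norm _ _).trans ?_
    rw [hth] at h1
    nlinarith [norm_nonneg h]
  have hφ : ∀ t ∈ Set.Icc (0 : ℝ) 1, ∀ t' ∈ Set.Icc (0 : ℝ) 1,
      f (x + t • h) + ⟪q (x + t • h), h⟫ * (t' - t) - (K / 2 * ‖h‖ ^ 2) * (t' - t) ^ 2
        ≤ f (x + t' • h) := by
    intro t _ t' _
    have := hf (x + t • h) (x + t' • h)
    have e : x + t' • h - (x + t • h) = (t' - t) • h := by rw [sub_smul]; abel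
    rw [e, inner_smul_right, norm_smul, mul_pow, Real.norm_eq_abs, sq_abs] at this
    linarith
  have up := le_of_increment_le (φ := fun t => f (x + t • h)) (s := fun t => ⟪q (x + t • h), h⟫)
    (K := K / 2 * ‖h‖ ^ 2) (α := ⟪q x, h⟫) (β := ⟪M h, h⟫ + 2 * η * ‖h‖ ^ 2) hφ
    (fun t ht => by linarith [(abs_le.1 (hslope t ht)).2])
  have lo := le_of_le_increment (φ := fun t => f (x + t • h)) (s := fun t => ⟪q (x + t • h), h⟫)
    (K := K / 2 * ‖h‖ ^ 2) (α := ⟪q x, h⟫) (β := ⟪M h, h⟫ - 2 * η * ‖h‖ ^ 2) hφ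
    (fun t ht => by linarith [(abs_le.1 (hslope t ht)).1])
  simp only [one_smul, zero_smul, add_zero] at up lo
  rw [abs_le]
  constructor <;> linarith

end Semiconvex

/-! ### Sup-convolutions and their maximizers -/

section SupConvolution

variable {E : Type*} [NormedAddCommGroup E]

/-- `f` is the sup-convolution of `u` over `B` with parameter `K`, and `Y` selects maximizers. -/
structure IsSupConvolution (B : Set E) (K : ℝ) (u f : E → ℝ) (Y : E → E) : Prop where
  mem : ∀ x, Y x ∈ B
  eq : ∀ x, f x = u (Y x) - K / 2 * ‖x - Y x‖ ^ 2
  le : ∀ x, ∀ y ∈ B, u y - K / 2 * ‖x - y‖ ^ 2 ≤ f x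

theorem exists_isSupConvolution {B : Set E} (hB : IsCompact B) (hne : B.Nonempty) (K : ℝ)
    {u : E → ℝ} (hu : ContinuousOn u B) : ∃ f Y, IsSupConvolution B K u f Y := by
  have h : ∀ x, ∃ y ∈ B, IsMaxOn (fun y => u y - K / 2 * ‖x - y‖ ^ 2) B y := fun x =>
    hB.exists_isMaxOn hne (hu.sub (by fun_prop))
  choose Y hY hmax using h
  exact ⟨_, Y, hY, fun x => rfl, fun x y hy => hmax x hy⟩

/-- The translation property of sup-convolutions: second-order upper expansions pass to the
original function at the maximizer. -/
theorem IsSupConvolution.le_translate {B : Set E} {K : ℝ} {u f : E → ℝ} {Y : E → E}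
    (h : IsSupConvolution B K u f Y) {x e : E} (he : Y x + e ∈ B) :
    u (Y x + e) - u (Y x) ≤ f (x + e) - f x := by
  have h1 := h.le (x + e) _ he
  rw [show x + e - (Y x + e) = x - Y x by abel] at h1
  rw [h.eq x]
  linarith

variable [InnerProductSpace ℝ E]

local notation "⟪" x ", " y "⟫" => inner ℝ x y

/-- The maximizer `Y y` remains a competitor at every `z`. This provides an explicit slope field, so
no subdifferential is needed. -/
theorem IsSupConvolution.le_of_slope {B : Set E} {K : ℝ} {u f : E → ℝ} {Y : E → E}
    (h : IsSupConvolution B K u f Y) (y z : E) :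
    f y + ⟪K • (Y y - y), z - y⟫ - K / 2 * ‖z - y‖ ^ 2 ≤ f z := by
  have h1 := h.le z (Y y) (h.mem y)
  have h2 : ‖z - Y y‖ ^ 2 = ‖z - y‖ ^ 2 - 2 * ⟪Y y - y, z - y⟫ + ‖y - Y y‖ ^ 2 := by
    rw [show z - Y y = (z - y) - (Y y - y) by abel, norm_sub_sq_real, norm_sub_rev (Y y) y,
      real_inner_comm]
  rw [h2] at h1
  rw [h.eq y, inner_smul_left]
  simp only [conj_trivial]
  linarith

/-- Completing the square in `x`: for given `y`, `z` the optimal `x` is explicit, so maximizing over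
all of `E` reduces to maximizing a continuous function on a compact product. -/
theorem two_paraboloids_identity {K : ℝ} (hK : 0 < K) (x y z p : E) :
    K / 2 * ‖x - y‖ ^ 2 + K / 2 * ‖x - z‖ ^ 2 + ⟪p, x⟫ =
      K / 4 * ‖y - z‖ ^ 2 + ⟪p, (2 : ℝ)⁻¹ • (y + z)⟫ - ‖p‖ ^ 2 / (4 * K)
        + K * ‖x - ((2 : ℝ)⁻¹ • (y + z) - (2 * K)⁻¹ • p)‖ ^ 2 := by
  simp only [← real_inner_self_eq_norm_sq, inner_sub_left, inner_sub_right, inner_add_left,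
    inner_add_right, inner_smul_left, inner_smul_right, conj_trivial]
  rw [real_inner_comm x y, real_inner_comm x z, real_inner_comm x p, real_inner_comm y z,
    real_inner_comm p y, real_inner_comm p z]
  field_simp
  ring

/-- Maximizers of a linear perturbation of the sum of two sup-convolutions exist. -/
theorem exists_max_sum_supConvolution {B : Set E} (hB : IsCompact B) (hne : B.Nonempty) {K : ℝ}
    (hK : 0 < K) {u₁ u₂ f₁ f₂ : E → ℝ} {Y₁ Y₂ : E → E}
    (hu₁ : ContinuousOn u₁ B) (hu₂ : ContinuousOn u₂ B)
    (h₁ : IsSupConvolution B K u₁ f₁ Y₁) (h₂ : IsSupConvolution B K u₂ f₂ Y₂) (p : E) :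
    ∃ x, ∀ x', f₁ x' + f₂ x' - ⟪p, x'⟫ ≤ f₁ x + f₂ x - ⟪p, x⟫ := by
  obtain ⟨⟨y, z⟩, ⟨hy, hz⟩, hmax⟩ := (hB.prod hB).exists_isMaxOn (hne.prod hne)
    (f := fun w : E × E => u₁ w.1 + u₂ w.2 - K / 4 * ‖w.1 - w.2‖ ^ 2
      - ⟪p, (2 : ℝ)⁻¹ • (w.1 + w.2)⟫)
    (by
      refine ContinuousOn.sub (ContinuousOn.sub (ContinuousOn.add ?_ ?_) ?_) ?_
      · exact hu₁.comp continuousOn_fst fun w hw => hw.1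
      · exact hu₂.comp continuousOn_snd fun w hw => hw.2
      · fun_prop
      · fun_prop)
  refine ⟨(2 : ℝ)⁻¹ • (y + z) - (2 * K)⁻¹ • p, fun x' => ?_⟩
  set x := (2 : ℝ)⁻¹ • (y + z) - (2 * K)⁻¹ • p with hx
  have h3 := hmax (show (Y₁ x', Y₂ x') ∈ B ×ˢ B from ⟨h₁.mem x', h₂.mem x'⟩)
  simp only [Set.mem_ofPred_eq] at h3
  have h4 := two_paraboloids_identity hK x' (Y₁ x') (Y₂ x') p
  have h5 := two_paraboloids_identity hK x y z p
  rw [← hx, sub_self, norm_zero] at h5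
  have h6 := h₁.le x y hy
  have h7 := h₂.le x z hz
  have h8 : 0 ≤ K * ‖x' - ((2 : ℝ)⁻¹ • (Y₁ x' + Y₂ x') - (2 * K)⁻¹ • p)‖ ^ 2 := by positivity
  rw [h₁.eq x', h₂.eq x']
  linarith

/-- For a large parameter, the maximizers stay away from the part of the boundary where the sum of
the two functions is small. -/
theorem supConvolution_mem_ball {K R m r η : ℝ} {u₁ u₂ f₁ f₂ : E → ℝ} {Y₁ Y₂ : E → E}
    (h₁ : IsSupConvolution (Metric.closedBall 0 1) K u₁ f₁ Y₁)
    (h₂ : IsSupConvolution (Metric.closedBall 0 1) K u₂ f₂ Y₂)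
    (hR₁ : ∀ x ∈ Metric.closedBall (0 : E) 1, |u₁ x| ≤ R)
    (hR₂ : ∀ x ∈ Metric.closedBall (0 : E) 1, |u₂ x| ≤ R)
    (hη₁ : ∀ x ∈ Metric.closedBall (0 : E) 1, ∀ y ∈ Metric.closedBall (0 : E) 1, dist x y < η →
      |u₁ x - u₁ y| ≤ m / 4)
    (hη₂ : ∀ x ∈ Metric.closedBall (0 : E) 1, ∀ y ∈ Metric.closedBall (0 : E) 1, dist x y < η →
      |u₂ x - u₂ y| ≤ m / 4)
    (hη : 0 < η) (hr : 0 < r) (hr2 : r ≤ 1 / 2) (hrm : r ≤ m / 16) (hK1 : 1 ≤ K)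
    (hK : 8 * (2 * R + 3) < K * η ^ 2)
    (hbd : ∀ x ∈ Metric.sphere (0 : E) 1, u₁ x + u₂ x ≤ m / 4)
    {x₀ : E} (hx₀ : x₀ ∈ Metric.closedBall (0 : E) 1) (hm : m ≤ u₁ x₀ + u₂ x₀)
    {p x : E} (hp : ‖p‖ ≤ r)
    (hmax : ∀ x', f₁ x' + f₂ x' - ⟪p, x'⟫ ≤ f₁ x + f₂ x - ⟪p, x⟫) :
    Y₁ x ∈ Metric.ball (0 : E) 1 ∧ Y₂ x ∈ Metric.ball (0 : E) 1 := by
  have hy := h₁.mem x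
  have hz := h₂.mem x
  have hv := hmax x₀
  rw [h₁.eq x, h₂.eq x] at hv
  have hf₁ := h₁.le x₀ x₀ hx₀
  have hf₂ := h₂.le x₀ x₀ hx₀
  simp only [sub_self, norm_zero] at hf₁ hf₂
  set y := Y₁ x
  set z := Y₂ x
  have n0 : ‖x₀‖ ≤ 1 := by simpa using hx₀
  have ny : ‖y‖ ≤ 1 := by simpa using hy
  have i0 : ⟪p, x₀⟫ ≤ r := by
    have := real_inner_le_norm p x₀
    nlinarith [norm_nonneg p, norm_nonneg x₀]
  have ix : -⟪p, x⟫ ≤ r + r * ‖x - y‖ := by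
    have h3 := (abs_le.1 (abs_real_inner_le_norm p x)).1
    have h4 : ‖x‖ ≤ 1 + ‖x - y‖ := by
      calc ‖x‖ = ‖y + (x - y)‖ := by congr 1; abel
        _ ≤ ‖y‖ + ‖x - y‖ := norm_add_le _ _
        _ ≤ _ := by linarith
    nlinarith [norm_nonneg p, norm_nonneg x]
  set s := ‖x - y‖ with hs
  set t := ‖x - z‖ with ht
  have hs0 : 0 ≤ s := norm_nonneg _
  have ht0 : 0 ≤ t := norm_nonneg _
  have main : m ≤ u₁ y + u₂ z - K / 2 * s ^ 2 - K / 2 * t ^ 2 + 2 * r + r * s := by linarith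
  have hyz : ‖y - z‖ ≤ s + t := by
    calc ‖y - z‖ = ‖(x - z) - (x - y)‖ := by congr 1; abel
      _ ≤ ‖x - z‖ + ‖x - y‖ := norm_sub_le _ _
      _ = s + t := by ring
  have b1 := (abs_le.1 (hR₁ y hy)).2
  have b2 := (abs_le.1 (hR₂ z hz)).2
  have rs : r * s ≤ r / 2 + r / 2 * s ^ 2 := by nlinarith [sq_nonneg (s - 1)]
  have rs2 : r / 2 * s ^ 2 ≤ K / 4 * s ^ 2 := by
    have : r / 2 ≤ K / 4 := by linarith
    gcongr
  have m0 : 0 < m := by linarith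
  -- Otherwise `K * η ^ 2 ≤ 2 * K * (s ^ 2 + t ^ 2)`, and the penalty would outweigh the bound `2 *
  -- R` on `u₁ y + u₂ z`.
  have hd : dist y z < η := by
    rw [dist_eq_norm]
    by_contra hcon
    push Not at hcon
    have h5 : η ^ 2 ≤ (s + t) ^ 2 := by
      have : η ≤ s + t := hcon.trans hyz
      gcongr
    have h6 : (s + t) ^ 2 ≤ 2 * (s ^ 2 + t ^ 2) := by nlinarith [sq_nonneg (s - t)]
    have h7 : K * η ^ 2 ≤ K * (2 * (s ^ 2 + t ^ 2)) := by
      have := h5.trans h6; gcongr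
    have h8 : 0 ≤ K * t ^ 2 := by positivity
    nlinarith
  have rs3 : r * s - K / 2 * s ^ 2 ≤ r := by
    have : 0 ≤ (K - 1) * s ^ 2 := by have : 0 ≤ K - 1 := by linarith
                                     positivity
    nlinarith [sq_nonneg (s - r)]
  have main2 : m ≤ u₁ y + u₂ z + 3 * r := by
    have : 0 ≤ K / 2 * t ^ 2 := by positivity
    linarith
  -- If one of the points were on the sphere, `u₁ y + u₂ z` would be at most `m / 4 + m / 4`; adding
  -- `3 * r ≤ 3 * m / 16` still leaves less than `m`.
  constructor
  · by_contra hcon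
    have hys : y ∈ Metric.sphere (0 : E) 1 := by
      simp only [Metric.mem_ball, Metric.mem_sphere, dist_zero_right, not_lt] at hcon ⊢
      exact le_antisymm ny hcon
    have := hbd y hys
    have := (abs_le.1 (hη₂ y hy z hz hd)).1
    linarith
  · by_contra hcon
    have nz : ‖z‖ ≤ 1 := by simpa using hz
    have hzs : z ∈ Metric.sphere (0 : E) 1 := by
      simp only [Metric.mem_ball, Metric.mem_sphere, dist_zero_right, not_lt] at hcon ⊢
      exact le_antisymm nz hcon
    have := hbd z hzs
    have := (abs_le.1 (hη₁ y hy z hz hd)).2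
    linarith

end SupConvolution

/-! ### Jensen's maximum principle -/

section JensenMaximumPrinciple

local notation "⟪" x ", " y "⟫" => inner ℝ x y

/-- Jensen's maximum principle: two functions whose sum has an interior positive maximum have, at
suitable interior points, second-order upper expansions whose Hessians have nonpositive sum. -/
theorem exists_second_order_expansions {d : ℕ} {u₁ u₂ : EuclideanSpace ℝ (Fin d) → ℝ} {m : ℝ}
    (hm : 0 < m)
    (hu₁ : ContinuousOn u₁ (Metric.closedBall 0 1)) (hu₂ : ContinuousOn u₂ (Metric.closedBall 0 1))
    (hbd : ∀ x ∈ Metric.sphere (0 : EuclideanSpace ℝ (Fin d)) 1, u₁ x + u₂ x ≤ m / 4)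
    {x₀ : EuclideanSpace ℝ (Fin d)} (hx₀ : x₀ ∈ Metric.closedBall 0 1)
    (hmx : m ≤ u₁ x₀ + u₂ x₀) :
    ∃ y ∈ Metric.ball (0 : EuclideanSpace ℝ (Fin d)) 1,
    ∃ z ∈ Metric.ball (0 : EuclideanSpace ℝ (Fin d)) 1,
    ∃ (p₁ p₂ : EuclideanSpace ℝ (Fin d))
      (M₁ M₂ : EuclideanSpace ℝ (Fin d) →L[ℝ] EuclideanSpace ℝ (Fin d)),
      (∀ η > 0, ∀ᶠ h in 𝓝 0, u₁ (y + h) ≤ u₁ y + ⟪p₁, h⟫ + ⟪M₁ h, h⟫ / 2 + η * ‖h‖ ^ 2) ∧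
      (∀ η > 0, ∀ᶠ h in 𝓝 0, u₂ (z + h) ≤ u₂ z + ⟪p₂, h⟫ + ⟪M₂ h, h⟫ / 2 + η * ‖h‖ ^ 2) ∧
      ∀ h, ⟪M₁ h, h⟫ + ⟪M₂ h, h⟫ ≤ 0 := by
  have hB := isCompact_closedBall (0 : EuclideanSpace ℝ (Fin d)) 1
  have hne : (Metric.closedBall (0 : EuclideanSpace ℝ (Fin d)) 1).Nonempty := ⟨x₀, hx₀⟩
  obtain ⟨R₁, hR₁⟩ := hB.exists_bound_of_continuousOn hu₁
  obtain ⟨R₂, hR₂⟩ := hB.exists_bound_of_continuousOn hu₂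
  obtain ⟨η₁, hη₁, hc₁⟩ := Metric.uniformContinuousOn_iff_le.1
    (hB.uniformContinuousOn_of_continuous hu₁) (m / 4) (by positivity)
  obtain ⟨η₂, hη₂, hc₂⟩ := Metric.uniformContinuousOn_iff_le.1
    (hB.uniformContinuousOn_of_continuous hu₂) (m / 4) (by positivity)
  set R := max R₁ R₂ with hR
  have hR0 : 0 ≤ R := (norm_nonneg _).trans ((hR₁ x₀ hx₀).trans (le_max_left _ _))
  set η := min η₁ η₂ with hη
  have hη0 : 0 < η := lt_min hη₁ hη₂
  set K := 1 + 8 * (2 * R + 3) / η ^ 2 with hK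
  have hK1 : 1 ≤ K := by
    have : 0 ≤ 8 * (2 * R + 3) / η ^ 2 := by positivity
    linarith
  have hK0 : 0 < K := by linarith
  have hKη : 8 * (2 * R + 3) < K * η ^ 2 := by
    rw [hK, add_mul, div_mul_cancel₀ _ (by positivity)]
    have : 0 < η ^ 2 := by positivity
    linarith
  set r := min (1 / 2) (m / 16) with hr
  have hr0 : 0 < r := by rw [hr]; positivity
  obtain ⟨f₁, Y₁, h₁⟩ := exists_isSupConvolution hB hne K hu₁
  obtain ⟨f₂, Y₂, h₂⟩ := exists_isSupConvolution hB hne K hu₂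
  set q₁ : EuclideanSpace ℝ (Fin d) → EuclideanSpace ℝ (Fin d) := fun x => K • (Y₁ x - x) with hq₁
  set q₂ : EuclideanSpace ℝ (Fin d) → EuclideanSpace ℝ (Fin d) := fun x => K • (Y₂ x - x) with hq₂
  have s₁ : ∀ y z, f₁ y + ⟪q₁ y, z - y⟫ - K / 2 * ‖z - y‖ ^ 2 ≤ f₁ z := h₁.le_of_slope
  have s₂ : ∀ y z, f₂ y + ⟪q₂ y, z - y⟫ - K / 2 * ‖z - y‖ ^ 2 ≤ f₂ z := h₂.le_of_slope
  set A : Set (EuclideanSpace ℝ (Fin d)) := {x | ∃ p, ‖p‖ ≤ r ∧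
    ∀ x', f₁ x' + f₂ x' - ⟪p, x'⟫ ≤ f₁ x + f₂ x - ⟪p, x⟫} with hA
  -- At a contact point each summand lies below a linear function minus the other, and the lower
  -- paraboloid of the other becomes an upper paraboloid for it.
  have touch : ∀ x p, (∀ x', f₁ x' + f₂ x' - ⟪p, x'⟫ ≤ f₁ x + f₂ x - ⟪p, x⟫) →
      q₁ x + q₂ x = p ∧ (∀ y, ‖q₁ y - q₁ x‖ ≤ 3 * K * ‖y - x‖) ∧
      ∀ y, ‖q₂ y - q₂ x‖ ≤ 3 * K * ‖y - x‖ := by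
    intro x p hmax
    obtain ⟨e₁, l₁⟩ := norm_slope_sub_le (f := f₁) (q := q₁) hK0.le s₁ (a := x) (b := p - q₂ x)
      (fun z => by
        have h3 := hmax z
        have h4 := s₂ x z
        rw [inner_sub_left, inner_sub_right p]
        linarith)
    obtain ⟨e₂, l₂⟩ := norm_slope_sub_le (f := f₂) (q := q₂) hK0.le s₂ (a := x) (b := p - q₁ x)
      (fun z => by
        have h3 := hmax z
        have h4 := s₁ x z
        rw [inner_sub_left, inner_sub_right p]
        linarith)
    exact ⟨by rw [e₁]; abel, l₁, l₂⟩
  set C : NNReal := ⟨3 * K, by positivity⟩ with hC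
  have hl₁ : ∀ a ∈ A, ∀ y, ‖q₁ y - q₁ a‖ ≤ C * ‖y - a‖ := by
    rintro a ⟨p, -, hmax⟩ y
    exact (touch a p hmax).2.1 y
  have hl₂ : ∀ a ∈ A, ∀ y, ‖q₂ y - q₂ a‖ ≤ C * ‖y - a‖ := by
    rintro a ⟨p, -, hmax⟩ y
    exact (touch a p hmax).2.2 y
  -- Every `p` in the ball of radius `r` is the total slope at some contact point, and a null set
  -- has no such Lipschitz image.
  have hAne : volume A ≠ 0 := by
    intro h0
    have hlip : LipschitzOnWith (C + C) (fun x => q₁ x + q₂ x) A := by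
      refine LipschitzOnWith.add ?_ ?_
      · exact LipschitzOnWith.of_dist_le_mul fun x _ y hy => by
          simpa [dist_eq_norm] using hl₁ y hy x
      · exact LipschitzOnWith.of_dist_le_mul fun x _ y hy => by
          simpa [dist_eq_norm] using hl₂ y hy x
    have h3 := hlip.volume_image_eq_zero h0
    have h4 : Metric.ball (0 : EuclideanSpace ℝ (Fin d)) r ⊆ (fun x => q₁ x + q₂ x) '' A := by
      intro p hp
      obtain ⟨x, hx⟩ := exists_max_sum_supConvolution hB hne hK0 hu₁ hu₂ h₁ h₂ p
      have hp' : ‖p‖ ≤ r := by simpa using (Metric.mem_ball.1 hp).le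
      exact ⟨x, ⟨p, hp', hx⟩, (touch x p hx).1⟩
    exact (Metric.measure_ball_pos volume _ hr0).ne' (measure_mono_null h4 h3)
  obtain ⟨x, ⟨p, hp, hmax⟩, d₁, d₂⟩ : ∃ x ∈ A, DifferentiableAt ℝ q₁ x ∧
      DifferentiableAt ℝ q₂ x := by
    by_contra hcon
    push Not at hcon
    refine hAne (measure_mono_null (fun x hx => ?_)
      ((ae_differentiableAt_of_lipschitz_at volume A C q₁ hl₁).and
        (ae_differentiableAt_of_lipschitz_at volume A C q₂ hl₂)))
    intro hx'
    exact hcon x hx (hx'.1 hx) (hx'.2 hx)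
  obtain ⟨hy, hz⟩ := supConvolution_mem_ball (R := R) (r := r) (η := η) (m := m) h₁ h₂
    (fun x hx => (hR₁ x hx).trans (le_max_left _ _))
    (fun x hx => (hR₂ x hx).trans (le_max_right _ _))
    (fun x hx y hy h => hc₁ x hx y hy (h.le.trans (min_le_left _ _)))
    (fun x hx y hy h => hc₂ x hx y hy (h.le.trans (min_le_right _ _)))
    hη0 hr0 (min_le_left _ _) (min_le_right _ _) hK1 hKη hbd hx₀ hmx hp hmax
  have t₁ : ∀ η : ℝ, 0 < η → _ := fun η hη => taylor_of_hasFDerivAt_slope s₁ d₁.hasFDerivAt (η := η) hη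
  have t₂ : ∀ η : ℝ, 0 < η → _ := fun η hη => taylor_of_hasFDerivAt_slope s₂ d₂.hasFDerivAt (η := η) hη
  have interior : ∀ y ∈ Metric.ball (0 : EuclideanSpace ℝ (Fin d)) 1,
      ∀ᶠ h in 𝓝 (0 : EuclideanSpace ℝ (Fin d)),
        y + h ∈ Metric.closedBall (0 : EuclideanSpace ℝ (Fin d)) 1 := by
    intro y hy
    have hc : ContinuousAt (fun h : EuclideanSpace ℝ (Fin d) => y + h) 0 := by fun_prop
    refine (hc.eventually (Metric.isOpen_ball.eventually_mem
      (show y + 0 ∈ Metric.ball 0 1 by simpa using hy))).mono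
      fun h hh => Metric.ball_subset_closedBall hh
  refine ⟨Y₁ x, hy, Y₂ x, hz, q₁ x, q₂ x, fderiv ℝ q₁ x, fderiv ℝ q₂ x, fun η hη => ?_,
    fun η hη => ?_, fun h => ?_⟩
  · filter_upwards [t₁ η hη, interior _ hy] with h h3 h4
    have := h₁.le_translate h4
    linarith [(abs_le.1 h3).2]
  · filter_upwards [t₂ η hη, interior _ hz] with h h3 h4
    have := h₂.le_translate h4
    linarith [(abs_le.1 h3).2]
  · have e := (touch x p hmax).1
    -- Maximality at `x` cancels the first-order terms; the second-order ones are compared along a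
    -- short segment and divided by `t ^ 2`.
    have key : ∀ η > 0, ⟪fderiv ℝ q₁ x h, h⟫ + ⟪fderiv ℝ q₂ x h, h⟫ ≤ η * (4 * ‖h‖ ^ 2) := by
      intro η hη
      have hc : Tendsto (fun t : ℝ => t • h) (𝓝[>] 0) (𝓝 0) := by
        have : Tendsto (fun t : ℝ => t • h) (𝓝 0) (𝓝 ((0 : ℝ) • h)) := by
          exact (continuous_id.smul continuous_const).tendsto 0
        rw [zero_smul] at this
        exact this.mono_left nhdsWithin_le_nhds
      obtain ⟨t, ⟨e₁, e₂⟩, ht⟩ := (((hc.eventually (t₁ η hη)).and (hc.eventually (t₂ η hη))).and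
        self_mem_nhdsWithin).exists
      have ht : 0 < t := ht
      have h3 := hmax (x + t • h)
      rw [← e, inner_add_right, inner_add_left _ _ (t • h)] at h3
      have h4 := (abs_le.1 e₁).1
      have h5 := (abs_le.1 e₂).1
      simp only [map_smul, inner_smul_left, inner_smul_right, conj_trivial, norm_smul,
        Real.norm_of_nonneg ht.le] at h3 h4 h5
      have h6 : t ^ 2 * (⟪fderiv ℝ q₁ x h, h⟫ + ⟪fderiv ℝ q₂ x h, h⟫)
          ≤ t ^ 2 * (η * (4 * ‖h‖ ^ 2)) := by linarith
      exact le_of_mul_le_mul_left h6 (by positivity)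
    refine le_of_forall_pos_le_add fun ε hε => ?_
    have h3 := key (ε / (4 * ‖h‖ ^ 2 + 1)) (by positivity)
    refine h3.trans ?_
    rw [zero_add, div_mul_eq_mul_div, div_le_iff₀ (by positivity)]
    nlinarith [sq_nonneg ‖h‖]

end JensenMaximumPrinciple

/-! ### Local integrability and weak derivatives -/

section LocalIntegrability

variable {d : ℕ}

local notation "𝔼" => EuclideanSpace ℝ (Fin d)

theorem MemLpLoc.mono {p : ℝ≥0∞} {U V : Set 𝔼} {g : 𝔼 → ℝ} (h : MemLpLoc p U g) (hVU : V ⊆ U) :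
    MemLpLoc p V g := fun K hK hKV => h K hK (hKV.trans hVU)

theorem Continuous.memLpLoc {p : ℝ≥0∞} {g : 𝔼 → ℝ} (hg : Continuous g) (U : Set 𝔼) :
    MemLpLoc p U g := by
  intro K hK _
  have : IsFiniteMeasure (volume.restrict K) := ⟨by simpa using hK.measure_lt_top⟩
  obtain ⟨C, hC⟩ := hK.exists_bound_of_continuousOn hg.continuousOn
  exact MemLp.of_bound hg.aestronglyMeasurable C (ae_restrict_of_forall_mem hK.measurableSet hC)

theorem MemLpLoc.add {p : ℝ≥0∞} {U : Set 𝔼} {g h : 𝔼 → ℝ} (hg : MemLpLoc p U g)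
    (hh : MemLpLoc p U h) : MemLpLoc p U (fun x => g x + h x) := fun K hK hKU =>
  (hg K hK hKU).add (hh K hK hKU)

theorem MemLpLoc.const_mul {p : ℝ≥0∞} {U : Set 𝔼} {g : 𝔼 → ℝ} (hg : MemLpLoc p U g) (c : ℝ) :
    MemLpLoc p U (fun x => c * g x) := fun K hK hKU => (hg K hK hKU).const_mul c

theorem MemLpLoc.integrable_mul {p : ℝ≥0∞} (hp : 1 ≤ p) {g η : 𝔼 → ℝ}
    (hg : MemLpLoc p Set.univ g) (hη : Continuous η) (hc : HasCompactSupport η) :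
    Integrable (fun x => g x * η x) := by
  have hK : IsCompact (tsupport η) := hc
  have : IsFiniteMeasure (volume.restrict (tsupport η)) := ⟨by simpa using hK.measure_lt_top⟩
  have h1 : IntegrableOn g (tsupport η) := (hg _ hK (Set.subset_univ _)).integrable hp
  have h2 : IntegrableOn (fun x => g x * η x) (tsupport η) :=
    h1.mul_continuousOn hη.continuousOn hK
  refine (integrableOn_iff_integrable_of_support_subset ?_).1 h2
  intro x hx
  refine subset_tsupport η ?_
  simp only [Function.mem_support, ne_eq, mul_eq_zero, not_or] at hx ⊢
  exact hx.2

theorem continuous_partialDeriv {η : 𝔼 → ℝ} (hη : ContDiff ℝ 1 η) (i : Fin d) :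
    Continuous (partialDeriv i η) :=
  (hη.continuous_fderiv (by norm_num)).clm_apply continuous_const

theorem HasCompactSupport.partialDeriv {η : 𝔼 → ℝ} (hη : HasCompactSupport η) (i : Fin d) :
    HasCompactSupport (partialDeriv i η) :=
  hη.fderiv_apply ℝ (coordVec i)

theorem IsWeakPartialDeriv.mono {U V : Set 𝔼} {i : Fin d} {g h : 𝔼 → ℝ}
    (H : IsWeakPartialDeriv U i g h) (hVU : V ⊆ U) : IsWeakPartialDeriv V i g h :=
  fun η h1 h2 h3 => H η h1 h2 (h3.trans hVU)

theorem IsWeakPartialDeriv.add {p : ℝ≥0∞} (hp : 1 ≤ p) {i : Fin d} {g₁ g₂ h₁ h₂ : 𝔼 → ℝ}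
    (H₁ : IsWeakPartialDeriv Set.univ i g₁ h₁) (H₂ : IsWeakPartialDeriv Set.univ i g₂ h₂)
    (mg₁ : MemLpLoc p Set.univ g₁) (mg₂ : MemLpLoc p Set.univ g₂)
    (mh₁ : MemLpLoc p Set.univ h₁) (mh₂ : MemLpLoc p Set.univ h₂) :
    IsWeakPartialDeriv Set.univ i (fun x => g₁ x + g₂ x) (fun x => h₁ x + h₂ x) := by
  intro η hη hc hs
  have hη1 : ContDiff ℝ 1 η := hη.of_le (by exact_mod_cast le_top)
  have c1 := continuous_partialDeriv hη1 i
  have c2 := hc.partialDeriv i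
  simp only [add_mul]
  rw [integral_add (mg₁.integrable_mul hp c1 c2) (mg₂.integrable_mul hp c1 c2),
    integral_add (mh₁.integrable_mul hp hη.continuous hc) (mh₂.integrable_mul hp hη.continuous hc),
    H₁ η hη hc hs, H₂ η hη hc hs]
  ring

theorem IsWeakPartialDeriv.const_mul {U : Set 𝔼} {i : Fin d} {g h : 𝔼 → ℝ}
    (H : IsWeakPartialDeriv U i g h) (c : ℝ) :
    IsWeakPartialDeriv U i (fun x => c * g x) (fun x => c * h x) := by
  intro η hη hc hs
  simp only [mul_assoc]
  rw [integral_const_mul, integral_const_mul, H η hη hc hs]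
  ring

/-- Classical derivatives are weak derivatives. -/
theorem ContDiff.isWeakPartialDeriv {g : 𝔼 → ℝ} (hg : ContDiff ℝ 1 g) (U : Set 𝔼) (i : Fin d) :
    IsWeakPartialDeriv U i g (partialDeriv i g) := by
  intro η hη hc hs
  have hη1 : ContDiff ℝ 1 η := hη.of_le (by exact_mod_cast le_top)
  have c1 := continuous_partialDeriv hη1 i
  have c2 := hc.partialDeriv i
  have one : (1 : ℝ≥0∞) ≤ 1 := le_rfl
  exact integral_mul_fderiv_eq_neg_fderiv_mul_of_integrable
    (MemLpLoc.integrable_mul one ((continuous_partialDeriv hg i).memLpLoc _) hη.continuous hc)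
    (MemLpLoc.integrable_mul one (hg.continuous.memLpLoc _) c1 c2)
    (MemLpLoc.integrable_mul one (hg.continuous.memLpLoc _) hη.continuous hc)
    (fun x _ => (hg.differentiable (by norm_num)) x)
    (fun x _ => (hη1.differentiable (by norm_num)) x)

end LocalIntegrability

/-! ### Powers of one coordinate -/

section PowerOfCoordinate

variable {d : ℕ}

local notation "𝔼" => EuclideanSpace ℝ (Fin d)

theorem ae_coord_ne_zero (i : Fin d) : ∀ᵐ x : 𝔼, x i ≠ 0 := by
  have h := Measure.addHaar_submodule (volume : Measure 𝔼)
    (LinearMap.ker (EuclideanSpace.proj i : 𝔼 →L[ℝ] ℝ).toLinearMap) (by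
      intro htop
      have : coordVec i ∈ LinearMap.ker (EuclideanSpace.proj i : 𝔼 →L[ℝ] ℝ).toLinearMap := by
        rw [htop]; trivial
      simp [coordVec] at this)
  refine measure_mono_null (fun x hx => ?_) h
  simpa using hx

theorem integrableOn_abs_rpow_neg {b : ℝ} (hb : b < 1) (R : ℝ) :
    IntegrableOn (fun t : ℝ => |t| ^ (-b)) (Metric.ball 0 R) := by
  refine integrableOn_ball_of_norm_le_rpow (C := 1) (α := b) (by simp) (by simpa using hb) ?_ ?_
  · exact Eventually.of_forall fun x => by
      rw [Real.norm_of_nonneg (by positivity), one_mul, Real.norm_eq_abs]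
  · exact (by fun_prop : Measurable fun t : ℝ => |t| ^ (-b)).aestronglyMeasurable

/-- On a cube the `p`-th power depends on a single factor of the product measure, so the claim is
the integrability of `|t| ^ (-(a * p))` near `0`. -/
theorem memLpLoc_abs_coord_rpow {a p : ℝ} (hp : 1 ≤ p) (hap : a * p < 1) (i : Fin d) :
    MemLpLoc (ENNReal.ofReal p) Set.univ (fun x : 𝔼 => |x i| ^ (-a)) := by
  intro K hK _
  obtain ⟨R, hR⟩ := hK.isBounded.subset_ball 0
  have hsub : K ⊆ WithLp.ofLp ⁻¹' (Set.univ.pi fun _ : Fin d => Metric.ball (0 : ℝ) R) := by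
    intro x hx
    simp only [Set.mem_preimage, Set.mem_univ_pi, Metric.mem_ball, dist_zero_right]
    intro j
    exact (PiLp.norm_apply_le x j).trans_lt (by simpa using hR hx)
  refine MemLp.mono_measure (Measure.restrict_mono hsub le_rfl) ?_
  have hmeas : Measurable fun x : 𝔼 => |x i| ^ (-a) := by fun_prop
  rw [← integrable_norm_rpow_iff hmeas.aestronglyMeasurable (by simp; linarith) (by simp),
    ENNReal.toReal_ofReal (by linarith)]
  have e : (fun x : 𝔼 => ‖|x i| ^ (-a)‖ ^ p)
      = (fun y : Fin d → ℝ => |y i| ^ (-(a * p))) ∘ WithLp.ofLp := by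
    funext x
    simp only [Function.comp]
    rw [Real.norm_of_nonneg (by positivity), ← Real.rpow_mul (abs_nonneg _), neg_mul]
  rw [e]
  have mp := (PiLp.volume_preserving_ofLp (Fin d)).restrict_preimage
    (s := Set.univ.pi fun _ : Fin d => Metric.ball (0 : ℝ) R)
    (MeasurableSet.univ_pi fun _ => measurableSet_ball)
  refine mp.integrable_comp_of_integrable ?_
  have : IsFiniteMeasure (volume.restrict (Metric.ball (0 : ℝ) R)) :=
    ⟨by simpa using (measure_ball_lt_top : volume (Metric.ball (0 : ℝ) R) < ⊤)⟩
  have h := integrable_comp_eval (μ := fun _ : Fin d => (volume : Measure ℝ).restrict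
    (Metric.ball (0 : ℝ) R)) (i := i) (integrableOn_abs_rpow_neg hap R)
  rw [volume_pi, Measure.restrict_pi_pi]
  exact h

/-- Up to the factor `2 - a` this is the derivative of the `C¹` function `|t| ^ (2 - a)`. -/
theorem continuous_mul_abs_rpow_neg {a : ℝ} (ha : a < 1) :
    Continuous fun t : ℝ => |t| ^ (-a) * t := by
  have h := (contDiff_norm_rpow (E := ℝ) (p := 2 - a) (by linarith)).continuous_deriv le_rfl
  have e : deriv (fun x : ℝ => ‖x‖ ^ (2 - a)) = fun t => (2 - a) * (|t| ^ (-a) * t) := by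
    funext t
    rw [(hasDerivAt_norm_rpow t (by linarith)).deriv, Real.norm_eq_abs, ← mul_assoc]
    congr 3; ring
  rw [e] at h
  have h2 := h.const_mul (2 - a)⁻¹
  have : (2 - a) ≠ 0 := by linarith
  simpa [← mul_assoc, inv_mul_cancel₀ this] using h2

/-- Regularization of `|t| ^ (-a) * t`, with `|t|` replaced by the square root of `t ^ 2 + ε`. -/
theorem contDiff_mul_rpow_sq_add {a ε : ℝ} (hε : 0 < ε) :
    ContDiff ℝ 1 fun t : ℝ => t * (t ^ 2 + ε) ^ (-a / 2) :=
  contDiff_id.mul (ContDiff.rpow_const_of_ne (by fun_prop) fun t => by positivity)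

theorem hasDerivAt_mul_rpow_sq_add {a ε : ℝ} (hε : 0 < ε) (t : ℝ) :
    HasDerivAt (fun t : ℝ => t * (t ^ 2 + ε) ^ (-a / 2))
      ((t ^ 2 + ε) ^ (-a / 2) * (1 - a * (t ^ 2 / (t ^ 2 + ε)))) t := by
  have hpos : 0 < t ^ 2 + ε := by positivity
  have h1 : HasDerivAt (fun t : ℝ => t ^ 2 + ε) (2 * t) t := by
    simpa using (hasDerivAt_pow 2 t).add_const ε
  have h2 := (hasDerivAt_id t).mul (h1.rpow_const (p := -a / 2) (Or.inl hpos.ne'))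
  have e : (t ^ 2 + ε) ^ (-a / 2) * (1 - a * (t ^ 2 / (t ^ 2 + ε))) =
      1 * (t ^ 2 + ε) ^ (-a / 2) + id t * (2 * t * (-a / 2) * (t ^ 2 + ε) ^ (-a / 2 - 1)) := by
    rw [Real.rpow_sub_one hpos.ne']
    simp only [id]
    field_simp
    ring
  rw [e]
  exact h2

theorem rpow_sq_add_le {a ε t : ℝ} (ha : 0 ≤ a) (hε : 0 ≤ ε) (ht : t ≠ 0) :
    (t ^ 2 + ε) ^ (-a / 2) ≤ |t| ^ (-a) := by
  have e : |t| ^ (-a) = (t ^ 2) ^ (-a / 2) := by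
    rw [← sq_abs, ← Real.rpow_natCast, ← Real.rpow_mul (abs_nonneg _)]
    congr 1; push_cast; ring
  rw [e]
  exact Real.rpow_le_rpow_of_nonpos (by positivity) (by linarith) (by linarith)

theorem tendsto_rpow_sq_add {a t : ℝ} (ht : t ≠ 0) :
    Tendsto (fun m : ℕ => (t ^ 2 + 1 / ((m : ℝ) + 1)) ^ (-a / 2)) atTop (𝓝 (|t| ^ (-a))) := by
  have e : |t| ^ (-a) = (t ^ 2 + 0) ^ (-a / 2) := by
    rw [← sq_abs, add_zero, ← Real.rpow_natCast, ← Real.rpow_mul (abs_nonneg _)]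
    congr 1; push_cast; ring
  rw [e]
  refine (tendsto_one_div_add_atTop_nhds_zero_nat.const_add _).rpow_const (Or.inl ?_)
  positivity

/-- The weak derivative of `|x_i|^{-a} x_i` for `a < 1`. -/
theorem isWeakPartialDeriv_mul_abs_rpow {a : ℝ} (ha0 : 0 ≤ a) (ha : a < 1) (i j : Fin d) :
    IsWeakPartialDeriv (Set.univ : Set 𝔼) j (fun x => |x i| ^ (-a) * x i)
      (fun x => (1 - a) * coordVec j i * |x i| ^ (-a)) := by
  intro η hη hc hs
  have hη1 : ContDiff ℝ 1 η := hη.of_le (by exact_mod_cast le_top)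
  have c1 := continuous_partialDeriv hη1 j
  have c2 := hc.partialDeriv j
  have one : (1 : ℝ≥0∞) ≤ 1 := le_rfl
  set ε : ℕ → ℝ := fun m => 1 / ((m : ℝ) + 1) with hε
  have hε0 : ∀ m, 0 < ε m := fun m => by positivity
  have hg : ∀ m, ContDiff ℝ 1 fun x : 𝔼 => x i * (x i ^ 2 + ε m) ^ (-a / 2) := fun m =>
    (contDiff_mul_rpow_sq_add (hε0 m)).comp (EuclideanSpace.proj i : 𝔼 →L[ℝ] ℝ).contDiff
  have hd : ∀ m x, partialDeriv j (fun x : 𝔼 => x i * (x i ^ 2 + ε m) ^ (-a / 2)) x =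
      (x i ^ 2 + ε m) ^ (-a / 2) * (1 - a * (x i ^ 2 / (x i ^ 2 + ε m))) * coordVec j i := by
    intro m x
    have h := (hasDerivAt_mul_rpow_sq_add (a := a) (hε0 m) (x i)).comp_hasFDerivAt x
      (EuclideanSpace.proj i : 𝔼 →L[ℝ] ℝ).hasFDerivAt
    change fderiv ℝ _ x (coordVec j) = _
    rw [show fderiv ℝ (fun x : 𝔼 => x i * (x i ^ 2 + ε m) ^ (-a / 2)) x = _ from
      HasFDerivAt.fderiv h]
    simp
  have hI : ∀ m, _ := fun m => (hg m).isWeakPartialDeriv Set.univ j η hη hc hs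
  have hloc : MemLpLoc 1 Set.univ fun x : 𝔼 => |x i| ^ (-a) := by
    have := memLpLoc_abs_coord_rpow (p := 1) (a := a) le_rfl (by linarith) i
    simpa using this
  have hcont : Continuous fun x : 𝔼 => |x i| ^ (-a) * x i :=
    (continuous_mul_abs_rpow_neg ha).comp (EuclideanSpace.proj i : 𝔼 →L[ℝ] ℝ).continuous
  have L : Tendsto (fun m => ∫ x : 𝔼, (x i * (x i ^ 2 + ε m) ^ (-a / 2)) * partialDeriv j η x) atTop
      (𝓝 (∫ x : 𝔼, (|x i| ^ (-a) * x i) * partialDeriv j η x)) := by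
    refine tendsto_integral_of_dominated_convergence
      (fun x => ‖(|x i| ^ (-a) * x i) * partialDeriv j η x‖)
      (fun m => ((hg m).continuous.mul c1).aestronglyMeasurable)
      (MemLpLoc.integrable_mul one (hcont.memLpLoc _) c1 c2).norm (fun m => ?_) ?_
    · filter_upwards [ae_coord_ne_zero i] with x hx
      rw [norm_mul, norm_mul, norm_mul, norm_mul, mul_comm ‖x i‖]
      gcongr
      rw [Real.norm_of_nonneg (by have := hε0 m; positivity), Real.norm_of_nonneg (by positivity)]
      exact rpow_sq_add_le ha0 (hε0 m).le hx
    · filter_upwards [ae_coord_ne_zero i] with x hx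
      rw [mul_comm (|x i| ^ (-a))]
      exact ((tendsto_rpow_sq_add hx).const_mul _).mul_const _
  have Rr : Tendsto (fun m => ∫ x : 𝔼,
      partialDeriv j (fun x : 𝔼 => x i * (x i ^ 2 + ε m) ^ (-a / 2)) x * η x) atTop
      (𝓝 (∫ x : 𝔼, ((1 - a) * coordVec j i * |x i| ^ (-a)) * η x)) := by
    refine tendsto_integral_of_dominated_convergence
      (fun x => ‖(|coordVec j i| * |x i| ^ (-a)) * η x‖)
      (fun m => ((continuous_partialDeriv (hg m) j).mul hη.continuous).aestronglyMeasurable)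
      (MemLpLoc.integrable_mul one (hloc.const_mul _) hη.continuous hc).norm (fun m => ?_) ?_
    · filter_upwards [ae_coord_ne_zero i] with x hx
      have hp : 0 < x i ^ 2 := by positivity
      rw [hd, norm_mul, norm_mul, norm_mul, norm_mul, norm_mul]
      have h1 : ‖(x i ^ 2 + ε m) ^ (-a / 2)‖ ≤ ‖|x i| ^ (-a)‖ := by
        rw [Real.norm_of_nonneg (by have := hε0 m; positivity), Real.norm_of_nonneg (by positivity)]
        exact rpow_sq_add_le ha0 (hε0 m).le hx
      -- Since `0 ≤ a < 1` the factor lies in `[0, 1]`, so `|x i| ^ (-a)` dominates uniformly in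
      -- `m`.
      have h2 : ‖1 - a * (x i ^ 2 / (x i ^ 2 + ε m))‖ ≤ 1 := by
        have h3 : x i ^ 2 / (x i ^ 2 + ε m) ≤ 1 := by
          rw [div_le_one (by have := hε0 m; positivity)]; linarith [hε0 m]
        have h4 : 0 ≤ x i ^ 2 / (x i ^ 2 + ε m) := by have := hε0 m; positivity
        rw [Real.norm_eq_abs, abs_le]
        constructor <;> nlinarith
      calc _ ≤ ‖|x i| ^ (-a)‖ * 1 * ‖(coordVec j i : ℝ)‖ * ‖η x‖ := by gcongr
        _ = _ := by simp only [Real.norm_eq_abs, abs_abs]; ring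
    · filter_upwards [ae_coord_ne_zero i] with x hx
      refine Tendsto.mul_const _ ?_
      have h0 : x i ^ 2 + 0 ≠ 0 := by positivity
      have h1 : Tendsto (fun m => 1 - a * (x i ^ 2 / (x i ^ 2 + ε m))) atTop
          (𝓝 (1 - a * (x i ^ 2 / (x i ^ 2 + 0)))) :=
        ((tendsto_const_nhds.div (tendsto_one_div_add_atTop_nhds_zero_nat.const_add _) h0).const_mul
          a).const_sub 1
      rw [add_zero, div_self (by positivity), mul_one] at h1
      have h2 := ((tendsto_rpow_sq_add (a := a) hx).mul h1).mul_const (coordVec j i)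
      simp only [hd]
      convert h2 using 2
      ring
  exact tendsto_nhds_unique (L.congr hI) Rr.neg

end PowerOfCoordinate

/-! ### The singular test function and its weak Hessian -/

section TestFunction

variable {d : ℕ}

local notation "𝔼" => EuclideanSpace ℝ (Fin d)
local notation "⟪" x ", " y "⟫" => inner ℝ x y

/-- The Hessian of the quadratic form `⟪T x, x⟫ / 2`. -/
noncomputable def quadHessian (T : 𝔼 →L[ℝ] 𝔼) : Matrix (Fin d) (Fin d) ℝ :=
  Matrix.of fun i j => (⟪T (coordVec i), coordVec j⟫ + ⟪T (coordVec j), coordVec i⟫) / 2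

/-- A quadratic polynomial perturbed by a power of the `i`-th coordinate. -/
noncomputable def testFunction (a c : ℝ) (k : Fin d) (b : 𝔼) (T : 𝔼 →L[ℝ] 𝔼) (x : 𝔼) : ℝ :=
  ⟪b, x⟫ + ⟪T x, x⟫ / 2 + c * |x k| ^ (2 - a)

/-- The weak Hessian of `testFunction`. -/
noncomputable def testHessian (a c : ℝ) (k : Fin d) (T : 𝔼 →L[ℝ] 𝔼) (x : 𝔼) : Matrix (Fin d) (Fin d) ℝ :=
  quadHessian T + (c * ((2 - a) * (1 - a)) * |x k| ^ (-a)) • Matrix.single k k 1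

theorem partialDeriv_quadratic (b : 𝔼) (T : 𝔼 →L[ℝ] 𝔼) (i : Fin d) :
    partialDeriv i (fun x => ⟪b, x⟫ + ⟪T x, x⟫ / 2) =
      fun x => ⟪b, coordVec i⟫ + (⟪T (coordVec i), x⟫ + ⟪T x, coordVec i⟫) / 2 := by
  funext x
  have h : HasFDerivAt (fun x => ⟪b, x⟫ + (2 : ℝ)⁻¹ * ⟪T x, x⟫) _ x :=
    ((hasFDerivAt_const b x).inner ℝ (hasFDerivAt_id x)).add
      ((T.hasFDerivAt.inner ℝ (hasFDerivAt_id x)).const_mul _)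
  have e : (fun x => ⟪b, x⟫ + ⟪T x, x⟫ / 2) = fun x => ⟪b, x⟫ + (2 : ℝ)⁻¹ * ⟪T x, x⟫ := by
    funext x; ring
  rw [partialDeriv, e, h.fderiv]
  simp
  ring

theorem partialDeriv_partialDeriv_quadratic (b : 𝔼) (T : 𝔼 →L[ℝ] 𝔼) (i j : Fin d) :
    partialDeriv j (fun x => ⟪b, coordVec i⟫ + (⟪T (coordVec i), x⟫ + ⟪T x, coordVec i⟫) / 2) =
      fun _ => quadHessian T i j := by
  funext x
  have h : HasFDerivAt (fun x => ⟪b, coordVec i⟫ +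
      (2 : ℝ)⁻¹ * (⟪T (coordVec i), x⟫ + ⟪T x, coordVec i⟫)) _ x :=
    ((((hasFDerivAt_const (T (coordVec i)) x).inner ℝ (hasFDerivAt_id x)).add
      (T.hasFDerivAt.inner ℝ (hasFDerivAt_const (coordVec i) x))).const_mul (2 : ℝ)⁻¹).const_add _
  have e : (fun x => ⟪b, coordVec i⟫ + (⟪T (coordVec i), x⟫ + ⟪T x, coordVec i⟫) / 2) =
      fun x => ⟪b, coordVec i⟫ + (2 : ℝ)⁻¹ * (⟪T (coordVec i), x⟫ + ⟪T x, coordVec i⟫) := by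
    funext x; ring
  rw [partialDeriv, e, h.fderiv]
  simp [quadHessian]
  ring

theorem continuous_testFunction {a : ℝ} (ha : a < 1) (c : ℝ) (k : Fin d) (b : 𝔼)
    (T : 𝔼 →L[ℝ] 𝔼) : Continuous (testFunction a c k b T) := by
  unfold testFunction
  have h1 : Continuous fun x : 𝔼 => |x k| ^ (2 - a) :=
    Continuous.rpow_const (by fun_prop) fun x => Or.inr (by linarith)
  fun_prop

/-- Only the `(k, k)` entry of the Hessian is singular, and it is a multiple of `|x k| ^ (-a)`: this
is where `a * p < 1` is decisive. -/
theorem isW2pLocWithHessian_testFunction {a p : ℝ} (ha0 : 0 ≤ a) (hp : 1 ≤ p) (hap : a * p < 1)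
    (c : ℝ) (k : Fin d) (b : 𝔼) (T : 𝔼 →L[ℝ] 𝔼) (U : Set 𝔼) :
    IsW2pLocWithHessian (ENNReal.ofReal p) U (testFunction a c k b T) (testHessian a c k T) := by
  have ha : a < 1 := by nlinarith
  have hp' : 1 ≤ ENNReal.ofReal p := by simpa using hp
  have hcd : ContDiff ℝ 1 fun x : 𝔼 => |x k| ^ (2 - a) := by
    have := (contDiff_norm_rpow (E := ℝ) (p := 2 - a) (by linarith)).comp
      (EuclideanSpace.proj k : 𝔼 →L[ℝ] ℝ).contDiff
    simpa [Function.comp_def] using this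
  have hpd : ∀ i, partialDeriv i (fun x : 𝔼 => |x k| ^ (2 - a)) =
      fun x => (2 - a) * coordVec i k * (|x k| ^ (-a) * x k) := by
    intro i
    funext x
    have h := (hasDerivAt_abs_rpow (x k) (p := 2 - a) (by linarith)).comp_hasFDerivAt x
      (EuclideanSpace.proj k : 𝔼 →L[ℝ] ℝ).hasFDerivAt
    change fderiv ℝ _ x (coordVec i) = _
    rw [show fderiv ℝ (fun x : 𝔼 => |x k| ^ (2 - a)) x = _ from HasFDerivAt.fderiv h, show 2 - a - 2 = -a by ring]
    simp
    ring
  have hquad : ContDiff ℝ 1 fun x : 𝔼 => ⟪b, x⟫ + ⟪T x, x⟫ / 2 :=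
    (contDiff_const.inner ℝ contDiff_id).add ((T.contDiff.inner ℝ contDiff_id).div_const 2)
  have hlin : ∀ i, ContDiff ℝ 1 fun x : 𝔼 =>
    ⟪b, coordVec i⟫ + (⟪T (coordVec i), x⟫ + ⟪T x, coordVec i⟫) / 2 := fun i =>
    contDiff_const.add (((contDiff_const.inner ℝ contDiff_id).add
      (T.contDiff.inner ℝ contDiff_const)).div_const 2)
  have hk : Continuous fun x : 𝔼 => |x k| ^ (-a) * x k :=
    (continuous_mul_abs_rpow_neg ha).comp (EuclideanSpace.proj k : 𝔼 →L[ℝ] ℝ).continuous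
  have hH : ∀ i j, (fun x => testHessian a c k T x i j) = fun x => quadHessian T i j +
      (c * ((2 - a) * coordVec i k)) * ((1 - a) * coordVec j k * |x k| ^ (-a)) := by
    intro i j
    funext x
    by_cases hi : k = i <;> by_cases hj : k = j <;>
      simp [testHessian, coordVec, Matrix.single_apply, hi, hj, mul_assoc]
  refine ⟨(continuous_testFunction ha c k b T).memLpLoc U, fun i x =>
    (⟪b, coordVec i⟫ + (⟪T (coordVec i), x⟫ + ⟪T x, coordVec i⟫) / 2)
      + (c * ((2 - a) * coordVec i k)) * (|x k| ^ (-a) * x k), fun i => ⟨?_, ?_⟩,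
    fun i j => ⟨?_, ?_⟩⟩
  · exact ((hlin i).continuous.add (hk.const_mul _)).memLpLoc U
  · have h1 := hquad.isWeakPartialDeriv Set.univ i
    rw [partialDeriv_quadratic] at h1
    have h2 := (hcd.isWeakPartialDeriv Set.univ i).const_mul c
    have h3 := (h1.add hp' h2 (hquad.continuous.memLpLoc _)
      ((hcd.continuous.const_mul c).memLpLoc _) ((hlin i).continuous.memLpLoc _)
      (((continuous_partialDeriv hcd i).const_mul c).memLpLoc _)).mono (Set.subset_univ U)
    rw [hpd] at h3
    simp only [mul_assoc] at h3 ⊢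
    exact h3
  · rw [hH]
    exact (((continuous_const.memLpLoc _).add
      (((memLpLoc_abs_coord_rpow hp hap k).const_mul _).const_mul _))).mono (Set.subset_univ U)
  · rw [hH]
    have h1 := (hlin i).isWeakPartialDeriv Set.univ j
    rw [partialDeriv_partialDeriv_quadratic] at h1
    exact (h1.add hp' ((isWeakPartialDeriv_mul_abs_rpow ha0 ha k j).const_mul _)
      ((hlin i).continuous.memLpLoc _) ((hk.const_mul _).memLpLoc _)
      (continuous_const.memLpLoc _)
      (((memLpLoc_abs_coord_rpow hp hap k).const_mul _).const_mul _)).mono (Set.subset_univ U)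

end TestFunction

/-! ### Touching by perturbed quadratic polynomials -/

section Comparison

variable {d : ℕ}

local notation "𝔼" => EuclideanSpace ℝ (Fin d)
local notation "⟪" x ", " y "⟫" => inner ℝ x y

theorem quadHessian_isSymm (T : 𝔼 →L[ℝ] 𝔼) : (quadHessian T).IsSymm := by
  ext i j
  simp [quadHessian, add_comm]

theorem quadHessian_add (S T : 𝔼 →L[ℝ] 𝔼) :
    quadHessian (S + T) = quadHessian S + quadHessian T := by
  ext i j
  simp [quadHessian, inner_add_left]
  ring

theorem quadHessian_posSemidef {T : 𝔼 →L[ℝ] 𝔼} (hT : ∀ h, 0 ≤ ⟪T h, h⟫) :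
    (quadHessian T).PosSemidef := by
  refine Matrix.PosSemidef.of_dotProduct_mulVec_nonneg ?_ fun x => ?_
  · rw [Matrix.IsHermitian, Matrix.conjTranspose_eq_transpose_of_trivial]
    exact quadHessian_isSymm T
  · have e : (WithLp.toLp 2 x : 𝔼) = ∑ i, x i • coordVec i := by
      ext j
      simp [coordVec, Finset.sum_apply, Pi.single_apply]
    have h := hT (WithLp.toLp 2 x)
    have h2 : dotProduct (star x) (Matrix.mulVec (quadHessian T) x) = ⟪T (WithLp.toLp 2 x), WithLp.toLp 2 x⟫ := by
      have h3 : ⟪T (WithLp.toLp 2 x), WithLp.toLp 2 x⟫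
          = ∑ i, ∑ j, x i * (x j * ⟪T (coordVec i), coordVec j⟫) := by
        rw [e, map_sum, sum_inner]
        refine Finset.sum_congr rfl fun i _ => ?_
        rw [inner_sum]
        refine Finset.sum_congr rfl fun j _ => ?_
        rw [map_smul, inner_smul_left, inner_smul_right]
        simp
      have h4 : ⟪T (WithLp.toLp 2 x), WithLp.toLp 2 x⟫
          = ∑ i, ∑ j, x i * (x j * ⟪T (coordVec j), coordVec i⟫) := by
        rw [h3, Finset.sum_comm]
        refine Finset.sum_congr rfl fun i _ => Finset.sum_congr rfl fun j _ => by ring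
      have h5 : dotProduct (star x) (Matrix.mulVec (quadHessian T) x) =
          ((∑ i, ∑ j, x i * (x j * ⟪T (coordVec i), coordVec j⟫))
          + ∑ i, ∑ j, x i * (x j * ⟪T (coordVec j), coordVec i⟫)) / 2 := by
        rw [← Finset.sum_add_distrib, Finset.sum_div]
        simp only [dotProduct, Matrix.mulVec, Pi.star_apply, star_trivial, Finset.mul_sum]
        refine Finset.sum_congr rfl fun i _ => ?_
        rw [← Finset.sum_add_distrib, Finset.sum_div]
        refine Finset.sum_congr rfl fun j _ => ?_
        simp only [quadHessian, Matrix.of_apply]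
        ring
      rw [h5, ← h3, ← h4]
      ring
    rw [h2]
    exact h

theorem testFunction_neg (a c : ℝ) (k : Fin d) (b : 𝔼) (T : 𝔼 →L[ℝ] 𝔼) (x : 𝔼) :
    testFunction a (-c) k b T x = - testFunction a c k (-b) (-T) x := by
  simp [testFunction]
  ring

/-- A function with a second-order upper expansion at an interior point is touched from above at
some interior point by a quadratic polynomial minus a multiple of a power of a coordinate. -/
theorem exists_isLocalMax_sub_testFunction {a : ℝ} (ha : a < 1) (k : Fin d) {u : 𝔼 → ℝ}
    (hu : ContinuousOn u (Metric.ball 0 1)) {x₀ p : 𝔼} (hx₀ : x₀ ∈ Metric.ball (0 : 𝔼) 1)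
    {M : 𝔼 →L[ℝ] 𝔼} {η : ℝ} (hη : 0 < η)
    (hexp : ∀ᶠ h in 𝓝 (0 : 𝔼), u (x₀ + h) ≤ u x₀ + ⟪p, h⟫ + ⟪M h, h⟫ / 2 + η * ‖h‖ ^ 2) :
    ∃ c > 0, ∃ b, ∃ x₁ ∈ Metric.ball (0 : 𝔼) 1, IsLocalMax (fun x => u x -
      testFunction a (-c) k b (M + (4 * η) • ContinuousLinearMap.id ℝ 𝔼) x) x₁ := by
  set T := M + (4 * η) • ContinuousLinearMap.id ℝ 𝔼 with hT
  -- The linear coefficient after recentring the quadratic form from `x₀` to the origin; the adjoint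
  -- appears because `T` need not be symmetric.
  set b : 𝔼 := p - (2 : ℝ)⁻¹ • (ContinuousLinearMap.adjoint T x₀ + T x₀) with hb
  have hball : ∀ᶠ x in 𝓝 x₀, x ∈ Metric.ball (0 : 𝔼) 1 := Metric.isOpen_ball.eventually_mem hx₀
  have hexp' : ∀ᶠ x in 𝓝 x₀,
      u x ≤ u x₀ + ⟪p, x - x₀⟫ + ⟪M (x - x₀), x - x₀⟫ / 2 + η * ‖x - x₀‖ ^ 2 := by
    have hc : Tendsto (fun x : 𝔼 => x - x₀) (𝓝 x₀) (𝓝 0) := by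
      have : ContinuousAt (fun x : 𝔼 => x - x₀) x₀ := by fun_prop
      simpa [ContinuousAt] using this
    filter_upwards [hc.eventually hexp] with x hx
    simpa using hx
  obtain ⟨ρ, hρ, hsub⟩ := Metric.nhds_basis_closedBall.eventually_iff.1 (hball.and hexp')
  have hcB : IsCompact (Metric.closedBall x₀ ρ) := isCompact_closedBall _ _
  -- On the sphere of radius `ρ` the enlarged paraboloid exceeds the expansion by at least `η * ρ ^
  -- 2`. Since `|x k| ^ (2 - a) ≤ 1` in the unit ball, half of this gap keeps the maximum interior.
  set c := η * ρ ^ 2 / 2 with hc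
  have hc0 : 0 < c := by positivity
  have hP : ∀ x, testFunction a (-c) k b T x = testFunction a 0 k b T x₀ + ⟪p, x - x₀⟫
      + ⟪M (x - x₀), x - x₀⟫ / 2 + 2 * η * ‖x - x₀‖ ^ 2 - c * |x k| ^ (2 - a) := by
    intro x
    have e1 : ⟪M (x - x₀), x - x₀⟫ / 2 + 2 * η * ‖x - x₀‖ ^ 2 = ⟪T (x - x₀), x - x₀⟫ / 2 := by
      rw [hT, ← real_inner_self_eq_norm_sq]
      simp only [add_apply, smul_apply,
        ContinuousLinearMap.id_apply, inner_add_left, inner_smul_left, conj_trivial]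
      ring
    have e2 : ⟪ContinuousLinearMap.adjoint T x₀, x⟫ = ⟪T x, x₀⟫ := by
      rw [ContinuousLinearMap.adjoint_inner_left, real_inner_comm]
    have e3 : ⟪ContinuousLinearMap.adjoint T x₀, x₀⟫ = ⟪T x₀, x₀⟫ := by
      rw [ContinuousLinearMap.adjoint_inner_left, real_inner_comm]
    simp only [testFunction, hb]
    rw [add_assoc (_ + ⟪p, x - x₀⟫), e1]
    simp only [inner_sub_left, inner_sub_right, map_sub, inner_smul_left, inner_add_left, e2, e3,
      conj_trivial]
    ring
  have hcont : ContinuousOn (fun x => u x - testFunction a (-c) k b T x)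
      (Metric.closedBall x₀ ρ) :=
    (hu.mono fun x hx => (hsub hx).1).sub (continuous_testFunction ha _ _ _ _).continuousOn
  obtain ⟨x₁, hx₁, hmax⟩ := hcB.exists_isMaxOn (Metric.nonempty_closedBall.2 hρ.le) hcont
  have hx₁' : x₁ ∈ Metric.ball x₀ ρ := by
    by_contra hcon
    have hn : ‖x₁ - x₀‖ = ρ := by
      rw [Metric.mem_ball, not_lt] at hcon
      rw [← dist_eq_norm]
      exact le_antisymm hx₁ hcon
    have h1 := hmax (Metric.mem_closedBall_self hρ.le)
    simp only [Set.mem_ofPred_eq] at h1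
    have h2 := (hsub hx₁).2
    rw [hP, hP, sub_self, map_zero, inner_zero_right, inner_zero_right, norm_zero] at h1
    rw [hn] at h1 h2
    have h3 : |x₁ k| ^ (2 - a) ≤ 1 := by
      refine Real.rpow_le_one (abs_nonneg _) ?_ (by linarith)
      have h4 := (hsub hx₁).1
      rw [Metric.mem_ball, dist_zero_right] at h4
      exact (PiLp.norm_apply_le x₁ k).trans h4.le
    have h5 : 0 ≤ |x₀ k| ^ (2 - a) := by positivity
    have h6 : 0 < η * ρ ^ 2 := by positivity
    nlinarith
  exact ⟨c, hc0, b, x₁, (hsub hx₁).1, hmax.isLocalMax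
    (mem_of_superset (Metric.isOpen_ball.mem_nhds hx₁') Metric.ball_subset_closedBall)⟩

end Comparison

/-! ### Removal of the weight and comparison -/

section DegenerateEquation

variable {n : ℕ}

local notation "𝔼" => EuclideanSpace ℝ (Fin (n + 1))
local notation "⟪" x ", " y "⟫" => inner ℝ x y

theorem posSemidef_single_last {t : ℝ} (ht : 0 ≤ t) :
    (t • Matrix.single (Fin.last n) (Fin.last n) (1 : ℝ)).PosSemidef := by
  have : t • Matrix.single (Fin.last n) (Fin.last n) (1 : ℝ)
      = Matrix.diagonal (Pi.single (Fin.last n) t) := by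
    rw [Matrix.diagonal_single]; simp
  rw [this]
  refine Matrix.PosSemidef.diagonal ?_
  intro i
  by_cases hi : i = Fin.last n
  · subst hi; simpa using ht
  · simp [hi]

theorem testHessian_isSymm (a c : ℝ) (T : 𝔼 →L[ℝ] 𝔼) (x : 𝔼) :
    (testHessian a c (Fin.last n) T x).IsSymm := by
  refine (quadHessian_isSymm T).add (Matrix.IsSymm.smul ?_ _)
  simp [Matrix.IsSymm]

-- The weight `|x_d| ^ a` cancels the singularity `|x_d| ^ (-a)` exactly, so ellipticity yields a
-- gap `κ` that does not deteriorate near the hyperplane.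
open scoped Matrix.Norms.L2Operator in
theorem IsUniformlyElliptic.degenerateOperator_testHessian {lam Lam : ℝ}
    {F : Matrix (Fin (n + 1)) (Fin (n + 1)) ℝ → ℝ} (hF : IsUniformlyElliptic lam Lam F)
    {a : ℝ} (ha : a < 1) {c : ℝ} (hc : 0 < c) (T : 𝔼 →L[ℝ] 𝔼) :
    ∃ κ > 0, ∀ x : 𝔼, x (Fin.last n) ≠ 0 →
      (F (quadHessian T) ≤ 0 →
        degenerateOperator a F (testHessian a (-c) (Fin.last n) T x) x ≤ -κ) ∧
      (0 ≤ F (quadHessian T) →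
        κ ≤ degenerateOperator a F (testHessian a c (Fin.last n) T x) x) := by
  obtain ⟨hlam, -, hell⟩ := hF
  set E := Matrix.single (Fin.last n) (Fin.last n) (1 : ℝ) with hE
  have hEn : 0 < ‖E‖ := norm_pos_iff.2 fun h => by
    have := congrFun (congrFun h (Fin.last n)) (Fin.last n)
    simp [hE] at this
  have hc' : 0 < c * ((2 - a) * (1 - a)) :=
    mul_pos hc (mul_pos (by linarith) (by linarith))
  refine ⟨lam * (c * ((2 - a) * (1 - a))) * ‖E‖, by positivity, fun x hx => ?_⟩
  have hx' : 0 < |x (Fin.last n)| := abs_pos.2 hx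
  set t := c * ((2 - a) * (1 - a)) * |x (Fin.last n)| ^ (-a) with ht
  have ht0 : 0 ≤ t := by positivity
  have hone : |x (Fin.last n)| ^ a * |x (Fin.last n)| ^ (-a) = 1 := by
    rw [← Real.rpow_add hx', add_neg_cancel, Real.rpow_zero]
  have hpow : 0 ≤ |x (Fin.last n)| ^ a := by positivity
  have hκ : |x (Fin.last n)| ^ a * (lam * ‖t • E‖) =
      lam * (c * ((2 - a) * (1 - a))) * ‖E‖ := by
    rw [norm_smul, Real.norm_of_nonneg ht0, ht]
    linear_combination (lam * (c * ((2 - a) * (1 - a))) * ‖E‖) * hone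
  rw [← hκ]
  constructor
  · intro h
    have h1 := (hell _ _ (testHessian_isSymm a (-c) T x) (posSemidef_single_last ht0)).1
    have e : testHessian a (-c) (Fin.last n) T x + t • E = quadHessian T := by
      rw [testHessian, ht, ← hE, add_assoc, ← add_smul]
      simp
    rw [e] at h1
    rw [degenerateOperator, ← mul_neg]
    exact mul_le_mul_of_nonneg_left (by linarith) hpow
  · intro h
    have h1 := (hell _ _ (quadHessian_isSymm T) (posSemidef_single_last ht0)).1
    have e : quadHessian T + t • E = testHessian a c (Fin.last n) T x := rfl
    rw [← hE, e] at h1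
    rw [degenerateOperator]
    exact mul_le_mul_of_nonneg_left (by linarith) hpow

variable {lam Lam a p : ℝ} {F : Matrix (Fin (n + 1)) (Fin (n + 1)) ℝ → ℝ}

/-- If `F (quadHessian T) ≤ 0`, the weighted operator is at most `-κ` off the hyperplane. The
essential upper limit ignores that null set, so contact on the hyperplane is excluded as well. -/
theorem IsLpViscositySubsolution.pos_of_isLocalMax (hF : IsUniformlyElliptic lam Lam F)
    (ha : 0 ≤ a) (hp : 1 ≤ p) (hap : a * p < 1) {u : 𝔼 → ℝ}
    (hu : IsLpViscositySubsolution (ENNReal.ofReal p) (Metric.ball 0 1) (degenerateOperator a F)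
      (fun _ => 0) u) {c : ℝ} (hc : 0 < c) {b : 𝔼} {T : 𝔼 →L[ℝ] 𝔼} {x₁ : 𝔼}
    (hx₁ : x₁ ∈ Metric.ball (0 : 𝔼) 1)
    (hmax : IsLocalMax (fun x => u x - testFunction a (-c) (Fin.last n) b T x) x₁) :
    0 < F (quadHessian T) := by
  by_contra hcon
  have ha1 : a < 1 := by nlinarith
  obtain ⟨κ, hκ, hH⟩ := hF.degenerateOperator_testHessian ha1 hc T
  have h1 := hu.2 _ _ (continuous_testFunction ha1 (-c) (Fin.last n) b T).continuousOn
    (isW2pLocWithHessian_testFunction ha hp hap (-c) (Fin.last n) b T _) x₁ hx₁ hmax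
  have h2 : essLimsupAt (fun x => degenerateOperator a F (testHessian a (-c) (Fin.last n) T x) x
      - 0) x₁ ≤ ((-κ : ℝ) : EReal) := by
    refine limsup_le_of_le (by isBoundedDefault) ?_
    refine Eventually.filter_mono inf_le_right ?_
    filter_upwards [ae_coord_ne_zero (Fin.last n)] with x hx
    rw [sub_zero]
    exact_mod_cast (hH x hx).1 (not_lt.1 hcon)
  have h3 := h1.trans h2
  have h4 : (0 : ℝ) ≤ -κ := by exact_mod_cast h3
  linarith

theorem IsLpViscositySupersolution.neg_of_isLocalMin (hF : IsUniformlyElliptic lam Lam F)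
    (ha : 0 ≤ a) (hp : 1 ≤ p) (hap : a * p < 1) {v : 𝔼 → ℝ}
    (hv : IsLpViscositySupersolution (ENNReal.ofReal p) (Metric.ball 0 1) (degenerateOperator a F)
      (fun _ => 0) v) {c : ℝ} (hc : 0 < c) {b : 𝔼} {T : 𝔼 →L[ℝ] 𝔼} {x₁ : 𝔼}
    (hx₁ : x₁ ∈ Metric.ball (0 : 𝔼) 1)
    (hmin : IsLocalMin (fun x => v x - testFunction a c (Fin.last n) b T x) x₁) :
    F (quadHessian T) < 0 := by
  by_contra hcon
  have ha1 : a < 1 := by nlinarith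
  obtain ⟨κ, hκ, hH⟩ := hF.degenerateOperator_testHessian ha1 hc T
  have h1 := hv.2 _ _ (continuous_testFunction ha1 c (Fin.last n) b T).continuousOn
    (isW2pLocWithHessian_testFunction ha hp hap c (Fin.last n) b T _) x₁ hx₁ hmin
  have h2 : ((κ : ℝ) : EReal) ≤ essLiminfAt (fun x =>
      degenerateOperator a F (testHessian a c (Fin.last n) T x) x - 0) x₁ := by
    refine le_liminf_of_le (by isBoundedDefault) ?_
    refine Eventually.filter_mono inf_le_right ?_
    filter_upwards [ae_coord_ne_zero (Fin.last n)] with x hx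
    rw [sub_zero]
    exact_mod_cast (hH x hx).2 (not_lt.1 hcon)
  have h3 := h2.trans h1
  have h4 : κ ≤ (0 : ℝ) := by exact_mod_cast h3
  linarith

/-- The comparison principle for `L^p` viscosity sub- and supersolutions of the degenerate
equation. -/
theorem IsLpViscositySubsolution.le_of_le_on_sphere (hF : IsUniformlyElliptic lam Lam F)
    (ha : 0 ≤ a) (hp : 1 ≤ p) (hap : a * p < 1) {u v : 𝔼 → ℝ}
    (cu : ContinuousOn u (Metric.closedBall 0 1)) (cv : ContinuousOn v (Metric.closedBall 0 1))
    (hu : IsLpViscositySubsolution (ENNReal.ofReal p) (Metric.ball 0 1) (degenerateOperator a F)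
      (fun _ => 0) u)
    (hv : IsLpViscositySupersolution (ENNReal.ofReal p) (Metric.ball 0 1) (degenerateOperator a F)
      (fun _ => 0) v)
    (hle : ∀ x ∈ Metric.sphere (0 : 𝔼) 1, u x ≤ v x) :
    ∀ x ∈ Metric.closedBall (0 : 𝔼) 1, u x ≤ v x := by
  intro x₀ hx₀
  by_contra hcon
  rw [not_le] at hcon
  have ha1 : a < 1 := by nlinarith
  set δ := (u x₀ - v x₀) / 2 with hδ
  have hδ0 : 0 < δ := by linarith
  -- The added `δ / 2 * ‖x‖ ^ 2` costs `δ / 2 = m / 4` on the sphere, and supplies the gap `δ` in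
  -- the Hessians.
  obtain ⟨y, hy, z, hz, p₁, p₂, M₁, M₂, h₁, h₂, hM⟩ := exists_second_order_expansions
    (u₁ := fun x => u x + δ / 2 * ‖x‖ ^ 2) (u₂ := fun x => - v x) (m := 2 * δ) (by linarith)
    (cu.add (by fun_prop)) cv.neg
    (fun x hx => by
      have h1 := hle x hx
      have h2 : ‖x‖ = 1 := by simpa using hx
      simp only [h2]
      linarith) hx₀ (by
      have : 0 ≤ δ / 2 * ‖x₀‖ ^ 2 := by positivity
      linarith)
  set I := ContinuousLinearMap.id ℝ 𝔼 with hI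
  obtain ⟨c₁, hc₁, b₁, x₁, hx₁, hm₁⟩ := exists_isLocalMax_sub_testFunction (u := u) (x₀ := y)
    (p := p₁ - δ • y) (M := M₁ - δ • I) (η := δ / 16) ha1 (Fin.last n) hu.1 hy (by positivity) (by
      filter_upwards [h₁ (δ / 16) (by positivity)] with h hh
      rw [norm_add_sq_real] at hh
      simp only [sub_apply, smul_apply, hI,
        ContinuousLinearMap.id_apply, inner_sub_left, inner_smul_left, conj_trivial,
        real_inner_self_eq_norm_sq]
      linarith)
  obtain ⟨c₂, hc₂, b₂, x₂, hx₂, hm₂⟩ := exists_isLocalMax_sub_testFunction (u := fun x => - v x)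
    (x₀ := z) (p := p₂) (M := M₂) (η := δ / 16) ha1 (Fin.last n) hv.1.neg hz (by positivity)
    (h₂ (δ / 16) (by positivity))
  have hpos := hu.pos_of_isLocalMax hF ha hp hap hc₁ hx₁ hm₁
  set T₁ := M₁ - δ • I + (4 * (δ / 16)) • I with hT₁
  set T₂ := M₂ + (4 * (δ / 16)) • I with hT₂
  have hm₂' : IsLocalMin (fun x => v x - testFunction a c₂ (Fin.last n) (-b₂) (-T₂) x) x₂ := by
    have := hm₂.neg
    refine this.congr (Eventually.of_forall fun x => ?_)
    simp only [testFunction_neg]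
    ring
  have hneg := hv.neg_of_isLocalMin hF ha hp hap hc₂ hx₂ hm₂'
  -- Each touching polynomial spends `δ / 4` of the gap, so `T₁ + T₂ = M₁ + M₂ - (δ / 2) • I` is
  -- still nonpositive as a quadratic form.
  have hN : (quadHessian (-T₂ - T₁)).PosSemidef := quadHessian_posSemidef fun h => by
    have := hM h
    simp only [hT₁, hT₂, hI, sub_apply, neg_apply,
      add_apply, smul_apply, ContinuousLinearMap.id_apply,
      inner_sub_left, inner_neg_left, inner_add_left, inner_smul_left, conj_trivial,
      real_inner_self_eq_norm_sq]
    nlinarith [sq_nonneg ‖h‖]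
  have hmono := (hF.2.2 _ _ (quadHessian_isSymm T₁) hN).1
  rw [← quadHessian_add, show T₁ + (-T₂ - T₁) = -T₂ by abel] at hmono
  have : 0 ≤ lam * (open scoped Matrix.Norms.L2Operator in ‖quadHessian (-T₂ - T₁)‖) :=
    mul_nonneg hF.1.le (open scoped Matrix.Norms.L2Operator in norm_nonneg _)
  linarith

theorem IsLpDirichletSolution.eqOn (hF : IsUniformlyElliptic lam Lam F)
    (ha : 0 ≤ a) (hp : 1 ≤ p) (hap : a * p < 1) {φ u v : 𝔼 → ℝ}
    (hu : IsLpDirichletSolution (ENNReal.ofReal p) a F φ u)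
    (hv : IsLpDirichletSolution (ENNReal.ofReal p) a F φ v) :
    Set.EqOn u v (Metric.closedBall 0 1) := by
  obtain ⟨cu, ⟨subu, supu⟩, bu⟩ := hu
  obtain ⟨cv, ⟨subv, supv⟩, bv⟩ := hv
  intro x hx
  exact le_antisymm
    (subu.le_of_le_on_sphere hF ha hp hap cu cv supv (fun y hy => by rw [bu y hy, bv y hy]) x hx)
    (subv.le_of_le_on_sphere hF ha hp hap cv cu supu (fun y hy => by rw [bu y hy, bv y hy]) x hx)

end DegenerateEquation

/-! ### Uniform ellipticity of the Laplacian -/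

section Trace

variable {d : ℕ}

open scoped Matrix.Norms.L2Operator in
theorem Matrix.PosSemidef.norm_eq_norm_eigenvalues {N : Matrix (Fin d) (Fin d) ℝ}
    (hN : N.PosSemidef) : ‖N‖ = ‖hN.1.eigenvalues‖ := by
  conv_lhs => rw [hN.1.spectral_theorem]
  rw [Unitary.conjStarAlgAut_apply]
  refine (CStarRing.norm_mul_mem_unitary _ (star hN.1.eigenvectorUnitary).2).trans ?_
  refine (CStarRing.norm_mem_unitary_mul _ hN.1.eigenvectorUnitary.2).trans ?_
  exact Matrix.l2_opNorm_diagonal _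

/-- For a positive semidefinite matrix the trace lies between the largest eigenvalue and `d` times
it. The constant `d + 1` keeps `lam ≤ Lam` valid for `d = 0`. -/
theorem isUniformlyElliptic_trace :
    IsUniformlyElliptic 1 (d + 1) (Matrix.trace : Matrix (Fin d) (Fin d) ℝ → ℝ) := by
  refine ⟨one_pos, by simp, fun M N _ hN => ?_⟩
  rw [Matrix.trace_add, add_sub_cancel_left, hN.norm_eq_norm_eigenvalues]
  have htr : N.trace = ∑ i, hN.1.eigenvalues i := by
    simpa using hN.1.trace_eq_sum_eigenvalues
  rw [htr]
  constructor
  · rw [one_mul]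
    refine (pi_norm_le_iff_of_nonneg (Finset.sum_nonneg fun i _ => hN.eigenvalues_nonneg i)).2
      fun i => ?_
    rw [Real.norm_of_nonneg (hN.eigenvalues_nonneg i)]
    exact Finset.single_le_sum (fun j _ => hN.eigenvalues_nonneg j) (Finset.mem_univ i)
  · calc ∑ i, hN.1.eigenvalues i ≤ ∑ _i : Fin d, ‖hN.1.eigenvalues‖ :=
        Finset.sum_le_sum fun i _ => (le_abs_self _).trans (norm_le_pi_norm hN.1.eigenvalues i)
      _ = d * ‖hN.1.eigenvalues‖ := by simp
      _ ≤ _ := by gcongr; simp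

end Trace

/-! ### Second derivative test along coordinate lines -/

section SecondDerivativeTest

/-- A positive second derivative would make `0` a local minimum too, so `w` would be locally
constant. -/
theorem IsLocalMax.second_deriv_nonpos {w w' : ℝ → ℝ} {w₂ : ℝ} (hmax : IsLocalMax w 0)
    (h₁ : ∀ᶠ t in 𝓝 0, HasDerivAt w (w' t) t) (h₂ : HasDerivAt w' w₂ 0) : w₂ ≤ 0 := by
  by_contra hcon
  rw [not_le] at hcon
  have e : deriv w =ᶠ[𝓝 0] w' := h₁.mono fun t ht => ht.deriv
  have hd : deriv (deriv w) 0 = w₂ := by rw [e.deriv_eq, h₂.deriv]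
  have hmin : IsLocalMin w 0 := isLocalMin_of_deriv_deriv_pos (by rw [hd]; exact hcon)
    hmax.deriv_eq_zero h₁.self_of_nhds.continuousAt
  have hconst : w =ᶠ[𝓝 0] fun _ => w 0 := by
    filter_upwards [hmax, hmin] with t h1 h2
    exact le_antisymm h1 h2
  have h0 : deriv w =ᶠ[𝓝 0] fun _ => 0 := by
    refine hconst.deriv.trans (Eventually.of_forall fun t => ?_)
    simp
  rw [h0.deriv_eq] at hd
  simp at hd
  linarith

variable {d : ℕ}

local notation "𝔼" => EuclideanSpace ℝ (Fin d)

theorem hasDerivAt_line (x e : 𝔼) (t : ℝ) : HasDerivAt (fun t : ℝ => x + t • e) e t := by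
  simpa using ((hasDerivAt_id t).smul_const e).const_add x

theorem tendsto_line (x e : 𝔼) : Tendsto (fun t : ℝ => x + t • e) (𝓝 0) (𝓝 x) := by
  have := (hasDerivAt_line x e 0).continuousAt
  simpa [ContinuousAt] using this

theorem ContDiffAt.eventually_hasDerivAt_line {φ : 𝔼 → ℝ} {x : 𝔼} (hφ : ContDiffAt ℝ 2 φ x)
    (i : Fin d) : ∀ᶠ t in 𝓝 (0 : ℝ), HasDerivAt (fun t => φ (x + t • coordVec i))
      (partialDeriv i φ (x + t • coordVec i)) t := by
  have h : ∀ᶠ y in 𝓝 x, ContDiffAt ℝ 2 φ y := hφ.eventually (by norm_num)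
  filter_upwards [(tendsto_line x (coordVec i)).eventually h] with t ht
  exact (ht.differentiableAt (by norm_num)).hasFDerivAt.comp_hasDerivAt t (hasDerivAt_line _ _ t)

theorem ContDiffAt.hasDerivAt_partialDeriv_line {φ : 𝔼 → ℝ} {x : 𝔼} (hφ : ContDiffAt ℝ 2 φ x)
    (i : Fin d) : HasDerivAt (fun t : ℝ => partialDeriv i φ (x + t • coordVec i))
      (hessianMatrix φ x i i) 0 := by
  have h : DifferentiableAt ℝ (partialDeriv i φ) x := by
    have h1 : ContDiffAt ℝ 1 (fderiv ℝ φ) x := hφ.fderiv_right (by norm_num)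
    exact (h1.differentiableAt (by norm_num)).clm_apply (differentiableAt_const _)
  have h2 : HasFDerivAt (partialDeriv i φ) (fderiv ℝ (partialDeriv i φ) x)
      (x + (0 : ℝ) • coordVec i) := by simpa using h.hasFDerivAt
  exact h2.comp_hasDerivAt 0 (hasDerivAt_line _ _ 0)

/-- `u` is twice differentiable at `x` along the coordinate lines, and its pure second derivatives
there sum up to zero. -/
def IsHarmonicAlongLines (u : 𝔼 → ℝ) (x : 𝔼) : Prop :=
  ∃ (w' : Fin d → ℝ → ℝ) (w₂ : Fin d → ℝ),
    (∀ i, ∀ᶠ t in 𝓝 (0 : ℝ), HasDerivAt (fun t => u (x + t • coordVec i)) (w' i t) t) ∧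
    (∀ i, HasDerivAt (w' i) (w₂ i) 0) ∧ ∑ i, w₂ i = 0

theorem IsHarmonicAlongLines.neg {u : 𝔼 → ℝ} {x : 𝔼} (h : IsHarmonicAlongLines u x) :
    IsHarmonicAlongLines (fun y => - u y) x := by
  obtain ⟨w', w₂, h1, h2, h3⟩ := h
  exact ⟨fun i t => - w' i t, fun i => - w₂ i, fun i => (h1 i).mono fun t ht => ht.neg,
    fun i => (h2 i).neg, by simp [h3]⟩

theorem IsHarmonicAlongLines.trace_nonneg {u φ : 𝔼 → ℝ} {x : 𝔼} (hu : IsHarmonicAlongLines u x)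
    (hφ : ContDiffAt ℝ 2 φ x) (hmax : IsLocalMax (fun y => u y - φ y) x) :
    0 ≤ (hessianMatrix φ x).trace := by
  obtain ⟨w', w₂, h1, h2, h3⟩ := hu
  have key : ∀ i, w₂ i - hessianMatrix φ x i i ≤ 0 := fun i => by
    have hm : IsLocalMax (fun t : ℝ => u (x + t • coordVec i) - φ (x + t • coordVec i)) 0 := by
      have := (tendsto_line x (coordVec i)).eventually hmax
      filter_upwards [this] with t ht
      simpa using ht
    refine hm.second_deriv_nonpos ?_ ((h2 i).sub (hφ.hasDerivAt_partialDeriv_line i))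
    filter_upwards [h1 i, hφ.eventually_hasDerivAt_line i] with t ht ht'
    exact ht.sub ht'
  have : ∑ i, w₂ i ≤ ∑ i, hessianMatrix φ x i i :=
    Finset.sum_le_sum fun i _ => by linarith [key i]
  rw [h3] at this
  exact this

theorem hessianMatrix_neg (φ : 𝔼 → ℝ) (x : 𝔼) :
    hessianMatrix (fun y => - φ y) x = - hessianMatrix φ x := by
  have h : ∀ (i : Fin d) (g : 𝔼 → ℝ), partialDeriv i (fun y => - g y)
      = fun y => - partialDeriv i g y := fun i g => by
    funext y; simp [partialDeriv, fderiv_fun_neg]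
  ext i j
  simp [hessianMatrix, h]

theorem IsHarmonicAlongLines.trace_nonpos {u φ : 𝔼 → ℝ} {x : 𝔼} (hu : IsHarmonicAlongLines u x)
    (hφ : ContDiffAt ℝ 2 φ x) (hmin : IsLocalMin (fun y => u y - φ y) x) :
    (hessianMatrix φ x).trace ≤ 0 := by
  have h := hu.neg.trace_nonneg (φ := fun y => - φ y) hφ.neg (by
    refine hmin.neg.congr (Eventually.of_forall fun y => ?_)
    ring)
  rw [hessianMatrix_neg, Matrix.trace_neg] at h
  linarith

end SecondDerivativeTest

/-! ### Two solutions for the Laplacian -/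

section NonUniqueness

variable {n : ℕ}

local notation "𝔼" => EuclideanSpace ℝ (Fin (n + 1))

/-- Harmonicity off the hyperplane suffices for being a `C` viscosity solution. -/
theorem isCViscositySolution_of_harmonic {a : ℝ} (ha : 0 < a) {u : 𝔼 → ℝ} (hu : Continuous u)
    (hh : ∀ x : 𝔼, x (Fin.last n) ≠ 0 → IsHarmonicAlongLines u x) :
    IsCViscositySolution (Metric.ball 0 1) (degenerateOperator a Matrix.trace) (fun _ => 0) u := by
  refine ⟨hu.continuousOn, fun φ hφ x hx => ?_⟩
  have hφx := hφ.contDiffAt (Metric.isOpen_ball.mem_nhds hx)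
  rcases eq_or_ne (x (Fin.last n)) 0 with h0 | h0
  -- On the hyperplane the weight is `0`, so both inequalities read `0 ≤ 0`.
  · simp [degenerateOperator, h0, Real.zero_rpow ha.ne']
  · exact ⟨fun hmax => mul_nonneg (by positivity) ((hh x h0).trace_nonneg hφx hmax),
      fun hmin => mul_nonpos_of_nonneg_of_nonpos (by positivity)
        ((hh x h0).trace_nonpos hφx hmin)⟩

/-- The Poisson kernel of the ball with pole `-e_d`, reflected evenly from the upper half-ball. -/
noncomputable def reflectedPoisson (x : 𝔼) : ℝ :=
  (1 - ‖x‖ ^ 2) * (‖x‖ ^ 2 + 2 * |x (Fin.last n)| + 1) ^ (-((n : ℝ) + 1) / 2)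

theorem continuous_reflectedPoisson : Continuous (reflectedPoisson (n := n)) := by
  unfold reflectedPoisson
  refine Continuous.mul (by fun_prop) (Continuous.rpow_const (by fun_prop) fun x => Or.inl ?_)
  positivity

/-- First derivative of `(1 - A - 2 B t - t²) (G₀ + 2 G₁ t + t²)^{-m/2}`. -/
theorem hasDerivAt_poisson_line (m A B G₀ G₁ t : ℝ) (hG : G₀ + 2 * G₁ * t + t ^ 2 ≠ 0) :
    HasDerivAt (fun t : ℝ => (1 - (A + 2 * B * t + t ^ 2)) * (G₀ + 2 * G₁ * t + t ^ 2) ^ (-m / 2))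
      (-(2 * B + 2 * t) * (G₀ + 2 * G₁ * t + t ^ 2) ^ (-m / 2) +
        (1 - (A + 2 * B * t + t ^ 2)) *
          ((2 * G₁ + 2 * t) * (-m / 2) * (G₀ + 2 * G₁ * t + t ^ 2) ^ (-m / 2 - 1))) t := by
  have q : ∀ a b : ℝ, HasDerivAt (fun t : ℝ => a + 2 * b * t + t ^ 2) (2 * b + 2 * t) t := by
    intro a b
    simpa using (((hasDerivAt_id t).const_mul (2 * b)).const_add a).fun_add (hasDerivAt_pow 2 t)
  exact ((q A B).const_sub 1).mul ((q G₀ G₁).rpow_const (Or.inl hG))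

/-- Second derivative of `(1 - A - 2 B t - t²) (G₀ + 2 G₁ t + t²)^{-m/2}` at `0`. -/
theorem hasDerivAt_deriv_poisson_line (m A B G₀ G₁ : ℝ) (hG : 0 < G₀) :
    HasDerivAt (fun t : ℝ => -(2 * B + 2 * t) * (G₀ + 2 * G₁ * t + t ^ 2) ^ (-m / 2) +
        (1 - (A + 2 * B * t + t ^ 2)) *
          ((2 * G₁ + 2 * t) * (-m / 2) * (G₀ + 2 * G₁ * t + t ^ 2) ^ (-m / 2 - 1)))
      (G₀ ^ (-m / 2 - 1 - 1) * (-2 * G₀ ^ 2 + 4 * m * B * G₁ * G₀ - m * (1 - A) * G₀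
        + m * (m + 2) * (1 - A) * G₁ ^ 2)) 0 := by
  have q : ∀ a b : ℝ, HasDerivAt (fun t : ℝ => a + 2 * b * t + t ^ 2) (2 * b) 0 := by
    intro a b
    simpa using (((hasDerivAt_id (0 : ℝ)).const_mul (2 * b)).const_add a).fun_add (hasDerivAt_pow 2 0)
  have l : ∀ b : ℝ, HasDerivAt (fun t : ℝ => 2 * b + 2 * t) 2 0 := by
    intro b
    simpa using ((hasDerivAt_id (0 : ℝ)).const_mul 2).const_add (2 * b)
  have hG' : G₀ + 2 * G₁ * 0 + 0 ^ 2 ≠ 0 := by simpa using hG.ne'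
  have h := ((l B).fun_neg.fun_mul ((q G₀ G₁).rpow_const (p := -m / 2) (Or.inl hG'))).fun_add
    (((q A B).const_sub 1).fun_mul (((l G₁).mul_const (-m / 2)).fun_mul
      ((q G₀ G₁).rpow_const (p := -m / 2 - 1) (Or.inl hG'))))
  refine HasDerivAt.congr_deriv h ?_
  have e1 : G₀ ^ (-m / 2) = G₀ ^ (-m / 2 - 1 - 1) * G₀ ^ 2 := by
    rw [Real.rpow_sub_one hG.ne', Real.rpow_sub_one hG.ne']; field_simp
  have e2 : G₀ ^ (-m / 2 - 1) = G₀ ^ (-m / 2 - 1 - 1) * G₀ := by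
    rw [Real.rpow_sub_one hG.ne' (-m / 2 - 1)]; field_simp
  simp only [mul_zero, add_zero, ne_eq, OfNat.ofNat_ne_zero, not_false_eq_true, zero_pow]
  rw [e1, e2]
  ring

theorem isHarmonicAlongLines_reflectedPoisson {x : 𝔼} (hx : x (Fin.last n) ≠ 0) :
    IsHarmonicAlongLines reflectedPoisson x := by
  -- `σ` is the sign of `x_d`, constant near `x`. There the function is the Poisson kernel with pole
  -- `-σ e_d`, and `G₁ i` below is the `i`-th coordinate of `x + σ e_d`.
  obtain ⟨σ, hσ, hσx⟩ : ∃ σ : ℝ, σ ^ 2 = 1 ∧ 0 < σ * x (Fin.last n) := by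
    rcases lt_or_gt_of_ne hx with h | h
    · exact ⟨-1, by norm_num, by linarith⟩
    · exact ⟨1, by norm_num, by linarith⟩
  set A := ‖x‖ ^ 2 with hA
  set G₀ := A + 2 * (σ * x (Fin.last n)) + 1 with hG₀
  have hG₀0 : 0 < G₀ := by positivity
  set G₁ : Fin (n + 1) → ℝ := fun i => x i + σ * coordVec i (Fin.last n) with hG₁
  set m : ℝ := (n : ℝ) + 1 with hm
  refine ⟨_, _, fun i => ?_, fun i => hasDerivAt_deriv_poisson_line m A (x i) G₀ (G₁ i) hG₀0, ?_⟩
  · have hne : ∀ᶠ t in 𝓝 (0 : ℝ), G₀ + 2 * G₁ i * t + t ^ 2 ≠ 0 := by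
      have : ContinuousAt (fun t : ℝ => G₀ + 2 * G₁ i * t + t ^ 2) 0 := by fun_prop
      exact this.eventually_ne (by simpa using hG₀0.ne')
    have hsign : ∀ᶠ t in 𝓝 (0 : ℝ), 0 < σ * (x + t • coordVec i) (Fin.last n) := by
      have : ContinuousAt (fun t : ℝ => σ * (x + t • coordVec i) (Fin.last n)) 0 := by fun_prop
      exact this.eventually_const_lt (by simpa using hσx)
    have heq : (fun t : ℝ => reflectedPoisson (x + t • coordVec i)) =ᶠ[𝓝 0] fun t =>
        (1 - (A + 2 * x i * t + t ^ 2)) * (G₀ + 2 * G₁ i * t + t ^ 2) ^ (-m / 2) := by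
      filter_upwards [hsign] with t ht
      have habs : |(x + t • coordVec i) (Fin.last n)| = σ * (x + t • coordVec i) (Fin.last n) := by
        have h1 : |σ| = 1 := by
          rw [← sq_eq_sq₀ (abs_nonneg _) zero_le_one, sq_abs, hσ]; norm_num
        rw [← abs_of_pos ht, abs_mul, h1, one_mul]
      have hn : ‖x + t • coordVec i‖ ^ 2 = A + 2 * x i * t + t ^ 2 := by
        rw [norm_add_sq_real, norm_smul, inner_smul_right, mul_pow, Real.norm_eq_abs, sq_abs]
        simp [coordVec, EuclideanSpace.inner_single_right]
        ring
      rw [reflectedPoisson, habs, hn]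
      congr 2
      simp [hG₀, hG₁]
      ring
    filter_upwards [heq.eventuallyEq_nhds, hne] with t h1 h2
    exact (hasDerivAt_poisson_line m A (x i) G₀ (G₁ i) t h2).congr_of_eventuallyEq h1
  · have s1 : ∑ i, x i ^ 2 = A := by rw [hA, EuclideanSpace.real_norm_sq_eq]
    have s2 : ∑ i, x i * (coordVec i : 𝔼) (Fin.last n) = x (Fin.last n) := by
      simp [coordVec]
    have s3 : ∑ i, ((coordVec i : 𝔼) (Fin.last n)) ^ 2 = 1 := by
      simp [coordVec]
    have s4 : ∑ i, x i * G₁ i = A + σ * x (Fin.last n) := by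
      rw [← s1, ← s2, Finset.mul_sum, ← Finset.sum_add_distrib]
      exact Finset.sum_congr rfl fun i _ => by simp only [hG₁]; ring
    have s5 : ∑ i, G₁ i ^ 2 = G₀ := by
      have : ∑ i, G₁ i ^ 2 = ∑ i, x i ^ 2 + 2 * σ * ∑ i, x i * (coordVec i : 𝔼) (Fin.last n)
          + σ ^ 2 * ∑ i, ((coordVec i : 𝔼) (Fin.last n)) ^ 2 := by
        rw [Finset.mul_sum, Finset.mul_sum, ← Finset.sum_add_distrib, ← Finset.sum_add_distrib]
        exact Finset.sum_congr rfl fun i _ => by simp only [hG₁]; ring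
      rw [this, s1, s2, s3, hσ, hG₀]
      ring
    rw [← Finset.mul_sum]
    have : ∑ i, (-2 * G₀ ^ 2 + 4 * m * x i * G₁ i * G₀ - m * (1 - A) * G₀
        + m * (m + 2) * (1 - A) * G₁ i ^ 2) = m * (-2 * G₀ ^ 2 - m * (1 - A) * G₀)
        + 4 * m * G₀ * ∑ i, x i * G₁ i + m * (m + 2) * (1 - A) * ∑ i, G₁ i ^ 2 := by
      rw [Finset.mul_sum, Finset.mul_sum]
      have hc : m * (-2 * G₀ ^ 2 - m * (1 - A) * G₀)
          = ∑ _i : Fin (n + 1), (-2 * G₀ ^ 2 - m * (1 - A) * G₀) := by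
        rw [Finset.sum_const, Finset.card_univ, Fintype.card_fin, nsmul_eq_mul, hm]; push_cast; ring
      rw [hc, ← Finset.sum_add_distrib, ← Finset.sum_add_distrib]
      exact Finset.sum_congr rfl fun i _ => by ring
    -- With `s = σ * x_d`, what remains is `m * G₀` times `-2 * G₀ - m * (1 - A) + 4 * (A + s) + (m
    -- + 2) * (1 - A)`, which vanishes for `G₀ = A + 2 * s + 1`.
    rw [this, s4, s5, hG₀]
    ring

theorem isCDirichletSolution_reflectedPoisson {a : ℝ} (ha : 0 < a) :
    IsCDirichletSolution (n := n) a Matrix.trace (fun _ => 0) reflectedPoisson := by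
  refine ⟨continuous_reflectedPoisson.continuousOn, isCViscositySolution_of_harmonic ha
    continuous_reflectedPoisson fun x => isHarmonicAlongLines_reflectedPoisson, fun x hx => ?_⟩
  have : ‖x‖ = 1 := by simpa using hx
  simp [reflectedPoisson, this]

theorem isCDirichletSolution_zero {a : ℝ} (ha : 0 < a) :
    IsCDirichletSolution (n := n) a Matrix.trace (fun _ => 0) (fun _ => 0) :=
  ⟨continuousOn_const, isCViscositySolution_of_harmonic ha continuous_const fun x _ =>
    ⟨fun _ _ => 0, fun _ => 0, fun _ => Eventually.of_forall fun t => hasDerivAt_const t 0,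
      fun _ => hasDerivAt_const 0 0, by simp⟩, fun _ _ => rfl⟩

end NonUniqueness

theorem corollary3p4 (n : ℕ) (a : ℝ) (ha : 0 < a) :
    (∀ (p : ℝ) (_ : 1 ≤ p) (_ : a * p < 1) (lam Lam : ℝ)
      (F : Matrix (Fin (n + 1)) (Fin (n + 1)) ℝ → ℝ) (_ : IsUniformlyElliptic lam Lam F)
      (φ u v : EuclideanSpace ℝ (Fin (n + 1)) → ℝ),
      IsLpDirichletSolution (ENNReal.ofReal p) a F φ u →
      IsLpDirichletSolution (ENNReal.ofReal p) a F φ v →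
      Set.EqOn u v (Metric.closedBall 0 1)) ∧
    (∃ (lam Lam : ℝ) (F : Matrix (Fin (n + 1)) (Fin (n + 1)) ℝ → ℝ)
      (φ u v : EuclideanSpace ℝ (Fin (n + 1)) → ℝ),
      IsUniformlyElliptic lam Lam F ∧
      IsCDirichletSolution a F φ u ∧ IsCDirichletSolution a F φ v ∧
      ¬ Set.EqOn u v (Metric.closedBall 0 1)) := by
  refine ⟨fun p hp hap lam Lam F hF φ u v hu hv => hu.eqOn hF ha.le hp hap hv,
    1, ((n + 1 : ℕ) : ℝ) + 1, Matrix.trace, fun _ => 0, reflectedPoisson, fun _ => 0,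
    isUniformlyElliptic_trace, isCDirichletSolution_reflectedPoisson ha,
    isCDirichletSolution_zero ha, fun h => ?_⟩
  -- At the origin the reflected kernel equals `1`.
  have := h (Metric.mem_closedBall_self zero_le_one)
  simp [reflectedPoisson] at this
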